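/- **Conventions.** A *biframe* is a triple $\mathcal L=(L^+,L^-,L)$ of frames with injective frame homomorphisms $e^\pm:L^\pm\to L$ such that every element of $L$ is a join of elements $e^+(x^+)\wedge e^-(x^-)$. A morphism $\mathcal L\to\mathcal M$ is a pair of frame homomorphisms $f^\pm:L^\pm\to M^\pm$ admitting a compatible frame homomorphism $L\to M$. *Finitary* elements of $L$, or of the frame coproduct $L^+\oplus L^-$, are finite joins of binary meets of a generator from $L^+$ and a generator from $L^-$; a congruence is *finitary* if it is generated by a relation between finitary elements; $\mathcal L$ is *finitary* if $L$ is isomorphic, compatibly with the generators, to $(L^+\oplus L^-)/C$ for some finitary congruence $C$. A *bispace* is a set with two topologies $\Omega^+,\Omega^-$; its *patch* is the topology generated by $\Omega^+\cup\Omega^-$. The bispectrum $\mathsf{bpt}(\mathcal L)$ is the set of biframe morphisms $f:\mathcal L\to(2,2,2)$, with positive opens $\{f: f^+(a)=1\}$, $a\in L^+$, and negative opens $\{f: f^-(b)=1\}$, $b\in L^-$. For a bispace $X$, $\mathsf{b}\Omega_{\mathsf{fin}}(X)=(\Omega^+(X),\Omega^-(X),\Omega_{\mathsf{fin}}(X))$,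 where $\Omega_{\mathsf{fin}}(X)$ is the quotient of $\Omega^+(X)\oplus\Omega^-(X)$ by the relations $U^+\wedge U^-\le V^+\vee V^-$ for all opens with $U^+\cap U^-\subseteq V^+\cup V^-$. $X$ is *bisober* if the map $X\to\mathsf{bpt}(\mathsf{b}\Omega_{\mathsf{fin}}(X))$ sending a point to its two neighbourhood maps is a bihomeomorphism; a finitary biframe $\mathcal M$ is *bispatial* if the pair of maps $a\mapsto\{f:f^\pm(a)=1\}$ is an isomorphism $\mathcal M\cong \mathsf{b}\Omega_{\mathsf{fin}}(\mathsf{bpt}(\mathcal M))$. $X$ is *bi-$T_D$* if every singleton is of the form $U^+\cap U^-\cap (V^+)^c\cap (V^-)^c$ with $U^\pm,V^\pm\in\Omega^\pm$. The Skula bispace $Sk(X)$ has the points of $X$; its positive topology is generated by the positive opens and the negative closed sets of $X$, its negative topology by the negative opens and the positive closed sets. A *bisubspace* is a subset with the two subspace topologies. The assembly $\mathsf A(\mathcal L)$ is the biframe of subframes of the frame of congruences of $L$ whose main component is generated by all closed congruences $\nabla(x)$, $x\in L$, and the open congruences $\Delta(s)$, $s\in L$ finitary, whose positive component is generated by all $\nabla(a^+),\Delta(a^-)$,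 and whose negative component is generated by all $\nabla(a^-),\Delta(a^+)$; $\nabla:\mathcal L\to\mathsf A(\mathcal L)$ is the canonical morphism. $\mathsf S(\mathcal L)$ is the set of biquotients $\mathcal L/C=(L^+/C^+,L^- /C^-,L/C)$, for $C$ a finitary congruence on $L$ and $C^\pm$ its restrictions, ordered by $\mathcal L/C\le\mathcal L/D$ iff $D\subseteq C$; $\mathsf{bisp}[\mathsf S(\mathcal L)]$ is the ordered subset of bispatial biquotients. The map $\mathsf{bpt}:\mathsf{bisp}[\mathsf S(\mathcal L)]\to\mathcal P(\mathsf{bpt}(\mathcal L))$ sends $\mathcal L/C$ to the image of $\mathsf{bpt}(q_C):\mathsf{bpt}(\mathcal L/C)\to\mathsf{bpt}(\mathcal L)$, where $q_C:\mathcal L\to\mathcal L/C$ is the quotient map. **Theorem.** Let $\mathcal L$ be a finitary biframe. Then there is a bihomeomorphism $\alpha: Sk(\mathsf{bpt}(\mathcal L))\cong\mathsf{bpt}(\mathsf A(\mathcal L))$ with $\alpha(f)\circ\nabla=f$ for all $f$; the ordered set $\mathsf{bisp}[\mathsf S(\mathcal L)]$ is a coframe; and $\mathsf{bpt}$ is an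 order isomorphism from $\mathsf{bisp}[\mathsf S(\mathcal L)]$ onto the set of bisober bisubspaces of $\mathsf{bpt}(\mathcal L)$ ordered by inclusion. Moreover, the following are equivalent. 1. The bispace $\mathsf{bpt}(\mathcal L)$ is bi-$T_D$. 2. The bispace $Sk(\mathsf{bpt}(\mathcal L))$ is patch-discrete (its patch is discrete); equivalently, $\mathsf{bpt}(\mathsf A(\mathcal L))$ is patch-discrete. 3. The coframe $\mathsf{bisp}[\mathsf S(\mathcal L)]$ of bispatial biquotients is a Boolean algebra. 4. All bisubspaces of $\mathsf{bpt}(\mathcal L)$ are bisober. 5. The map $\mathsf{bpt}:\mathsf{bisp}[\mathsf S(\mathcal L)]\to\mathcal P(\mathsf{bpt}(\mathcal L))$ is an isomorphism. -/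

import Mathlib

universe u v w

/-! ### Frame congruences and quotients of frames -/

/-- A congruence on a frame: an equivalence relation compatible with binary meets and with
arbitrary joins. -/
structure FrameCongruence (A : Type u) [Order.Frame A] extends Setoid A where
  inf' : ∀ {a b c d : A}, r a b → r c d → r (a ⊓ c) (b ⊓ d)
  iSup' : ∀ {ι : Type u} (f g : ι → A), (∀ i, r (f i) (g i)) → r (⨆ i, f i) (⨆ i, g i)

namespace FrameCongruence

variable {A B : Type u} {N : Type*} [Order.Frame A] [Order.Frame B] [Order.Frame N]

theorem r_ext {C D : FrameCongruence A} (h : ∀ x y, C.r x y ↔ D.r x y) : C = D := by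
  obtain ⟨⟨r, hr⟩, _, _⟩ := C
  obtain ⟨⟨s, hs⟩, _, _⟩ := D
  have : r = s := by
    funext x y
    exact propext (h x y)
  subst this
  rfl

theorem iSup_rel (C : FrameCongruence A) {ι : Sort*} (f g : ι → A) (h : ∀ i, C.r (f i) (g i)) :
    C.r (⨆ i, f i) (⨆ i, g i) := by
  have key := C.iSup' (ι := Set.range fun i => (f i, g i)) (fun p => p.1.1) (fun p => p.1.2) (by
    rintro ⟨_, i, rfl⟩
    exact h i)
  have h1 : (⨆ p : Set.range fun i => (f i, g i), p.1.1) = ⨆ i, f i :=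
    iSup_range' (fun p : A × A => p.1) (fun i => (f i, g i))
  have h2 : (⨆ p : Set.range fun i => (f i, g i), p.1.2) = ⨆ i, g i :=
    iSup_range' (fun p : A × A => p.2) (fun i => (f i, g i))
  rwa [h1, h2] at key

theorem sup_rel (C : FrameCongruence A) {a b c d : A} (h : C.r a b) (h' : C.r c d) :
    C.r (a ⊔ c) (b ⊔ d) := by
  have := C.iSup_rel (fun i : Bool => cond i a c) (fun i => cond i b d) (by
    rintro (_ | _)
    · exact h'
    · exact h)
  simpa only [sup_eq_iSup] using this

/-- Congruences are ordered by inclusion. -/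
instance : PartialOrder (FrameCongruence A) where
  le C D := ∀ x y, C.r x y → D.r x y
  le_refl _ _ _ h := h
  le_trans _ _ _ h h' x y hxy := h' x y (h x y hxy)
  le_antisymm _ _ h h' := r_ext fun x y => ⟨h x y, h' x y⟩

instance : InfSet (FrameCongruence A) where
  sInf S :=
    { r := fun x y => ∀ C ∈ S, C.r x y
      iseqv := ⟨fun _ C _ => C.refl' _, fun h C hC => C.symm' (h C hC),
        fun h h' C hC => C.trans' (h C hC) (h' C hC)⟩
      inf' := fun h h' C hC => C.inf' (h C hC) (h' C hC)
      iSup' := fun f g h C hC => C.iSup' f g fun i => h i C hC }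

instance : CompleteLattice (FrameCongruence A) where
  inf C D :=
    { r := fun x y => C.r x y ∧ D.r x y
      iseqv := ⟨fun x => ⟨C.refl' x, D.refl' x⟩, fun h => ⟨C.symm' h.1, D.symm' h.2⟩,
        fun h h' => ⟨C.trans' h.1 h'.1, D.trans' h.2 h'.2⟩⟩
      inf' := fun h h' => ⟨C.inf' h.1 h'.1, D.inf' h.2 h'.2⟩
      iSup' := fun f g h => ⟨C.iSup' f g fun i => (h i).1, D.iSup' f g fun i => (h i).2⟩ }
  inf_le_left _ _ _ _ h := h.1
  inf_le_right _ _ _ _ h := h.2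
  le_inf _ _ _ h h' x y hxy := ⟨h x y hxy, h' x y hxy⟩
  __ := completeLatticeOfInf (FrameCongruence A) fun _ =>
    ⟨fun _ hC _ _ h => h _ hC, fun _ hD x y h _ hC => hD hC x y h⟩

/-- The relative pseudocomplement of two congruences. -/
def imp (C D : FrameCongruence A) : FrameCongruence A where
  r x y := ∀ u v, C.r u v → u ≤ v → D.r ((x ⊓ v) ⊔ u) ((y ⊓ v) ⊔ u)
  iseqv := ⟨fun _ _ _ _ _ => D.refl' _, fun h u v k l => D.symm' (h u v k l),
    fun h h' u v k l => D.trans' (h u v k l) (h' u v k l)⟩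
  inf' {a b c d} h h' u v k l := by
    have e (p q : A) : (p ⊓ q ⊓ v) ⊔ u = ((p ⊓ v) ⊔ u) ⊓ ((q ⊓ v) ⊔ u) := by
      rw [← sup_inf_right, inf_inf_distrib_right]
    rw [e, e]
    exact D.inf' (h u v k l) (h' u v k l)
  iSup' {ι} f g h u v k l := by
    have e (f : ι → A) : ((⨆ i, f i) ⊓ v) ⊔ u = (⨆ i, (f i ⊓ v) ⊔ u) ⊔ u := by
      rw [iSup_inf_eq]
      apply le_antisymm
      · exact sup_le_sup_right (iSup_mono fun i => le_sup_left) u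
      · exact sup_le (iSup_le fun i => sup_le_sup_right (le_iSup (fun i => f i ⊓ v) i) u)
          le_sup_right
    rw [e, e]
    exact D.sup_rel (D.iSup_rel _ _ fun i => h i u v k l) (D.refl' u)

theorem inf_imp_le (C D : FrameCongruence A) : C ⊓ C.imp D ≤ D := by
  rintro x y ⟨h, h'⟩
  have hx : D.r x (x ⊓ y) := by
    have := h' (x ⊓ y) x (by simpa using C.inf' (C.refl' x) (C.symm' h)) inf_le_left
    simpa [inf_comm] using this
  have hy : D.r (x ⊓ y) y := by
    have := h' (x ⊓ y) y (by simpa using C.inf' h (C.refl' y)) inf_le_right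
    simpa using this
  exact D.trans' hx hy

theorem le_imp {C D F : FrameCongruence A} (h : C ⊓ F ≤ D) : F ≤ C.imp D := by
  intro x y hxy u v huv huv'
  have hC (z : A) : C.r ((z ⊓ v) ⊔ u) u := by
    have := C.sup_rel (C.inf' (C.refl' z) (C.symm' huv)) (C.refl' u)
    simpa using this
  exact h _ _ ⟨C.trans' (hC x) (C.symm' (hC y)),
    F.sup_rel (F.inf' hxy (F.refl' v)) (F.refl' u)⟩

/-- The assembly of a frame: its congruences, ordered by inclusion, form a frame. -/
instance : Order.Frame (FrameCongruence A) := .ofMinimalAxioms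
  { inf_sSup_le_iSup_inf := fun C S => by
      have h : sSup S ≤ C.imp (⨆ D ∈ S, C ⊓ D) :=
        sSup_le fun D hD => le_imp (le_iSup₂_of_le D hD le_rfl)
      exact (inf_le_inf_left C h).trans (inf_imp_le _ _) }

theorem sSup_le_iff_rel {S : Set (FrameCongruence A)} {D : FrameCongruence A} :
    sSup S ≤ D ↔ ∀ C ∈ S, ∀ x y, C.r x y → D.r x y :=
  sSup_le_iff

/-- The kernel of a frame homomorphism. -/
def ker (f : FrameHom A N) : FrameCongruence A where
  r x y := f x = f y
  iseqv := ⟨fun _ => rfl, fun h => h.symm, fun h h' => h.trans h'⟩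
  inf' h h' := by rw [map_inf, map_inf, h, h']
  iSup' f' g' h := by simp only [map_iSup, h]

/-- The restriction of a congruence along a frame homomorphism. -/
def comap (f : FrameHom A B) (C : FrameCongruence B) : FrameCongruence A where
  r x y := C.r (f x) (f y)
  iseqv := ⟨fun _ => C.refl' _, fun h => C.symm' h, fun h h' => C.trans' h h'⟩
  inf' h h' := by
    rw [map_inf, map_inf]
    exact C.inf' h h'
  iSup' f' g' h := by
    rw [map_iSup, map_iSup]
    exact C.iSup' _ _ h

/-- The congruence generated by a relation, whose pairs are read as inequalities: the least
congruence `C` such that `[x] ≤ [y]` holds in the quotient by `C` for all `(x, y) ∈ R`. -/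
def generate (R : Set (A × A)) : FrameCongruence A :=
  sInf {C | ∀ p ∈ R, C.r (p.1 ⊓ p.2) p.1}

theorem generate_le_ker (R : Set (A × A)) (f : FrameHom A N) (h : ∀ p ∈ R, f p.1 ≤ f p.2) :
    generate R ≤ ker f := by
  refine sInf_le fun p hp => ?_
  change f (p.1 ⊓ p.2) = f p.1
  rw [map_inf]
  exact inf_eq_left.2 (h p hp)

/-- The quotient of a frame by a congruence. -/
def QFrame (C : FrameCongruence A) : Type u := Quotient C.toSetoid

namespace QFrame

variable (C : FrameCongruence A)

/-- The class of an element. -/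
def of (x : A) : C.QFrame := Quotient.mk C.toSetoid x

/-- The largest representative of a class. -/
def rep (q : C.QFrame) : A := sSup {x | of C x = q}

variable {C}

theorem of_eq_of {x y : A} : of C x = of C y ↔ C.r x y := Quotient.eq

theorem of_rep (q : C.QFrame) : of C (rep C q) = q := by
  induction q using Quotient.inductionOn with
  | h x =>
    change of C (rep C (of C x)) = of C x
    rw [of_eq_of, rep, sSup_eq_iSup']
    have h := C.iSup_rel (fun y : {y | of C y = of C x} => y.1) (fun _ => x)
      fun y => of_eq_of.1 y.2
    have : Nonempty {y | of C y = of C x} := ⟨⟨x, rfl⟩⟩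
    have e : (⨆ _ : {y | of C y = of C x}, x) = x := ciSup_const
    rwa [e] at h

instance : PartialOrder C.QFrame :=
  PartialOrder.lift (rep C) fun p q h => by rw [← of_rep p, h, of_rep]

theorem gc : GaloisConnection (of C) (rep C) := by
  intro x q
  constructor
  · intro h
    exact (le_sSup (show x ∈ {y | of C y = of C x} from rfl)).trans h
  · intro h
    refine sSup_le fun y hy => ?_
    have h1 : C.r (y ⊔ rep C q) (x ⊔ rep C q) := C.sup_rel (of_eq_of.1 hy) (C.refl' _)
    rw [sup_eq_right.2 h] at h1
    have h2 : of C (y ⊔ rep C q) = q := (of_eq_of.2 h1).trans (of_rep q)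
    exact le_sup_left.trans (le_sSup h2)

/-- Taking classes and taking largest representatives form a Galois insertion. -/
def gi : GaloisInsertion (of C) (rep C) :=
  gc.toGaloisInsertion fun q => (of_rep q).ge

instance : CompleteLattice C.QFrame := gi.liftCompleteLattice

theorem of_inf (x y : A) : of C (x ⊓ y) = of C x ⊓ of C y := by
  apply le_antisymm
  · exact le_inf (gc.monotone_l inf_le_left) (gc.monotone_l inf_le_right)
  · change of C (rep C (of C x) ⊓ rep C (of C y)) ≤ _
    exact (of_eq_of.2 (C.inf' (of_eq_of.1 (of_rep _)) (of_eq_of.1 (of_rep _)))).le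

instance : Order.Frame C.QFrame := .ofMinimalAxioms
  { inf_sSup_le_iSup_inf := fun a S => by
      have hS : sSup S = of C (⨆ s ∈ S, rep C s) := by
        rw [gc.l_iSup₂, sSup_eq_iSup]
        simp only [of_rep]
      rw [hS, ← of_rep a, ← of_inf, inf_iSup₂_eq, gc.l_iSup₂]
      simp only [of_inf, of_rep]
      exact le_rfl }

variable (C) in
/-- The quotient map, as a frame homomorphism. -/
def mk : FrameHom A C.QFrame where
  toFun := of C
  map_inf' := of_inf
  map_top' := by
    apply top_le_iff.1
    rw [← of_rep (⊤ : C.QFrame)]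
    exact gc.monotone_l le_top
  map_sSup' S := by rw [gc.l_sSup, sSup_image]

theorem mk_surjective : Function.Surjective (mk C) := fun q => ⟨rep C q, of_rep q⟩

theorem mk_eq_mk {x y : A} : mk C x = mk C y ↔ C.r x y := of_eq_of

/-- The frame homomorphism induced on the quotient. -/
def lift (f : FrameHom A N) (h : C ≤ ker f) : FrameHom C.QFrame N where
  toFun := Quotient.lift f h
  map_inf' p q := by
    obtain ⟨x, rfl⟩ := mk_surjective p
    obtain ⟨y, rfl⟩ := mk_surjective q
    rw [← map_inf]
    exact map_inf f x y
  map_top' := by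
    rw [← map_top (mk C)]
    exact map_top f
  map_sSup' S := by
    have hS : S = mk C '' (rep C '' S) := by
      rw [Set.image_image]
      exact (Set.image_id S).symm.trans (Set.image_congr fun q _ => (of_rep q).symm)
    have h1 (x : A) : Quotient.lift f h (mk C x) = f x := rfl
    have h2 : Quotient.lift f h '' (mk C '' (rep C '' S)) = f '' (rep C '' S) :=
      Set.image_image (Quotient.lift f h) (mk C) (rep C '' S)
    rw [hS, ← map_sSup (mk C), h1, map_sSup, ← h2]
    rfl

@[simp] theorem lift_mk (f : FrameHom A N) (h : C ≤ ker f) (x : A) : lift f h (mk C x) = f x :=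
  rfl

end QFrame

/-- The closed congruence `∇(a)`, generated by `a ≤ 0`. -/
def nabla (a : A) : FrameCongruence A where
  r x y := x ⊔ a = y ⊔ a
  iseqv := ⟨fun _ => rfl, fun h => h.symm, fun h h' => h.trans h'⟩
  inf' h h' := by rw [sup_inf_right, sup_inf_right, h, h']
  iSup' {ι} f g h := by
    have e (f : ι → A) : (⨆ i, f i) ⊔ a = (⨆ i, f i ⊔ a) ⊔ a :=
      le_antisymm (sup_le_sup_right (iSup_mono fun i => le_sup_left) a)
        (sup_le (iSup_le fun i => sup_le_sup_right (le_iSup f i) a) le_sup_right)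
    rw [e, e g]
    simp only [h]

/-- The open congruence `Δ(a)`, generated by `1 ≤ a`. -/
def delta (a : A) : FrameCongruence A where
  r x y := x ⊓ a = y ⊓ a
  iseqv := ⟨fun _ => rfl, fun h => h.symm, fun h h' => h.trans h'⟩
  inf' {b c d e} h h' := by
    rw [inf_inf_distrib_right b d a, inf_inf_distrib_right c e a, h, h']
  iSup' f g h := by
    rw [iSup_inf_eq, iSup_inf_eq]
    simp only [h]

theorem nabla_le_iff {a : A} {D : FrameCongruence A} : nabla a ≤ D ↔ D.r a ⊥ := by
  constructor
  · intro h
    exact h _ _ (by change a ⊔ a = ⊥ ⊔ a; simp)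
  · intro h x y hxy
    have e (z : A) : D.r (z ⊔ a) z := by simpa using D.sup_rel (D.refl' z) h
    change x ⊔ a = y ⊔ a at hxy
    exact D.trans' (D.symm' (e x)) (hxy ▸ e y)

theorem delta_le_iff {a : A} {D : FrameCongruence A} : delta a ≤ D ↔ D.r a ⊤ := by
  constructor
  · intro h
    exact h _ _ (by change a ⊓ a = ⊤ ⊓ a; simp)
  · intro h x y hxy
    have e (z : A) : D.r (z ⊓ a) z := by simpa using D.inf' (D.refl' z) h
    change x ⊓ a = y ⊓ a at hxy
    exact D.trans' (D.symm' (e x)) (hxy ▸ e y)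

/-- The frame embedding of a frame into its assembly. -/
def nablaHom : FrameHom A (FrameCongruence A) where
  toFun := nabla
  map_inf' a b := r_ext fun x y => by
    change x ⊔ a ⊓ b = y ⊔ a ⊓ b ↔ x ⊔ a = y ⊔ a ∧ x ⊔ b = y ⊔ b
    constructor
    · intro h
      have e (z c : A) (hc : a ⊓ b ≤ c) : z ⊔ c = (z ⊔ a ⊓ b) ⊔ c := by
        rw [sup_assoc, sup_eq_right.2 hc]
      exact ⟨by rw [e x a inf_le_left, h, ← e y a inf_le_left],
        by rw [e x b inf_le_right, h, ← e y b inf_le_right]⟩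
    · rintro ⟨h, h'⟩
      rw [sup_inf_left, sup_inf_left, h, h']
  map_top' := top_le_iff.1 fun x y _ => by
    change x ⊔ ⊤ = y ⊔ ⊤
    simp
  map_sSup' S := by
    refine eq_of_forall_ge_iff fun D => ?_
    rw [nabla_le_iff, sSup_le_iff, Set.forall_mem_image]
    simp only [nabla_le_iff]
    constructor
    · intro h a ha
      have := D.inf' (D.refl' a) h
      rw [inf_eq_left.2 (le_sSup ha), inf_bot_eq] at this
      exact this
    · intro h
      have := D.iSup_rel (fun a : S => a.1) (fun _ => ⊥) fun a => h a.2
      rwa [iSup_bot, ← sSup_eq_iSup'] at this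

theorem delta_inf (a b : A) : delta (a ⊓ b) = delta a ⊔ delta b := by
  refine eq_of_forall_ge_iff fun D => ?_
  rw [sup_le_iff, delta_le_iff, delta_le_iff, delta_le_iff]
  constructor
  · intro h
    exact ⟨by simpa using D.sup_rel (D.refl' a) h, by simpa using D.sup_rel (D.refl' b) h⟩
  · rintro ⟨h, h'⟩
    simpa using D.inf' h h'

theorem delta_sup (a b : A) : delta (a ⊔ b) = delta a ⊓ delta b := r_ext fun x y => by
  change x ⊓ (a ⊔ b) = y ⊓ (a ⊔ b) ↔ x ⊓ a = y ⊓ a ∧ x ⊓ b = y ⊓ b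
  constructor
  · intro h
    have e (z c : A) (hc : c ≤ a ⊔ b) : z ⊓ c = (z ⊓ (a ⊔ b)) ⊓ c := by
      rw [inf_assoc, inf_eq_right.2 hc]
    exact ⟨by rw [e x a le_sup_left, h, ← e y a le_sup_left],
      by rw [e x b le_sup_right, h, ← e y b le_sup_right]⟩
  · rintro ⟨h, h'⟩
    rw [inf_sup_left, inf_sup_left, h, h']

theorem delta_bot : delta (⊥ : A) = ⊤ := top_le_iff.1 fun x y _ => by
  change x ⊓ ⊥ = y ⊓ ⊥
  simp

end FrameCongruence

/-! ### Subframes -/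

/-- A subframe: a subset closed under finite meets and arbitrary joins. -/
structure Subframe (A : Type u) [Order.Frame A] where
  carrier : Set A
  top_mem : ⊤ ∈ carrier
  inf_mem : ∀ {a b}, a ∈ carrier → b ∈ carrier → a ⊓ b ∈ carrier
  sSup_mem : ∀ S ⊆ carrier, sSup S ∈ carrier

namespace Subframe

variable {A B : Type u} [Order.Frame A] [Order.Frame B]

instance : CoeSort (Subframe A) (Type u) := ⟨fun S => {x : A // x ∈ S.carrier}⟩

instance (S : Subframe A) : CompleteLattice S where
  top := ⟨⊤, S.top_mem⟩
  le_top a := le_top (a := a.1)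
  inf a b := ⟨a.1 ⊓ b.1, S.inf_mem a.2 b.2⟩
  inf_le_left a b := inf_le_left (a := a.1)
  inf_le_right a b := inf_le_right (a := a.1)
  le_inf _ _ _ h h' := Subtype.coe_le_coe.1 (le_inf h h')
  __ := @completeLatticeOfSup S _
    ⟨fun T => ⟨sSup (Subtype.val '' T), S.sSup_mem _ (by rintro _ ⟨x, _, rfl⟩; exact x.2)⟩⟩
    fun T => ⟨fun _ hx => Subtype.coe_le_coe.1 (le_sSup (Set.mem_image_of_mem _ hx)),
      fun _ hb => Subtype.coe_le_coe.1 (sSup_le (by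
        rintro _ ⟨x, hx, rfl⟩
        exact hb hx))⟩

theorem coe_sSup (S : Subframe A) (T : Set S) :
    ((sSup T : S) : A) = sSup ((fun x : S => (x : A)) '' T) := rfl

theorem coe_inf (S : Subframe A) (a b : S) : ((a ⊓ b : S) : A) = (a : A) ⊓ (b : A) := rfl

instance (S : Subframe A) : Order.Frame S := .ofMinimalAxioms
  { inf_sSup_le_iSup_inf := fun a T => by
      rw [← sSup_image, ← Subtype.coe_le_coe, coe_inf, coe_sSup, coe_sSup, sSup_image,
        inf_iSup₂_eq, Set.image_image, sSup_image]
      exact le_rfl }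

/-- The least subframe containing a set. -/
def closure (X : Set A) : Subframe A where
  carrier := {x | ∀ S : Subframe A, X ⊆ S.carrier → x ∈ S.carrier}
  top_mem S _ := S.top_mem
  inf_mem h h' S hS := S.inf_mem (h S hS) (h' S hS)
  sSup_mem T hT S hS := S.sSup_mem T fun _ hx => hT hx S hS

theorem subset_closure (X : Set A) : X ⊆ (closure X).carrier := fun _ hx _ hS => hS hx

theorem closure_subset {X : Set A} {S : Subframe A} (h : X ⊆ S.carrier) :
    (closure X).carrier ⊆ S.carrier := fun _ hx => hx S h

/-- The inclusion of a subframe into a larger one. -/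
def inclusion {S T : Subframe A} (h : S.carrier ⊆ T.carrier) : FrameHom S T where
  toFun x := ⟨x.1, h x.2⟩
  map_inf' _ _ := rfl
  map_top' := rfl
  map_sSup' X := Subtype.ext (by
    rw [coe_sSup]
    change sSup _ = sSup _
    rw [Set.image_image])

/-- Restriction of the codomain of a frame homomorphism to a subframe. -/
def codRestrict (f : FrameHom A B) (S : Subframe B) (h : ∀ a, f a ∈ S.carrier) :
    FrameHom A S where
  toFun a := ⟨f a, h a⟩
  map_inf' a b := Subtype.ext (map_inf f a b)
  map_top' := Subtype.ext (map_top f)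
  map_sSup' X := Subtype.ext (by
    rw [coe_sSup, Set.image_image]
    exact map_sSup f X)

/-- The joins of binary meets of elements of two subframes form a subframe. -/
def joins (P N : Subframe A) : Subframe A where
  carrier := {x | x ≤ ⨆ q ∈ {q : P × N | (q.1 : A) ⊓ q.2 ≤ x}, (q.1 : A) ⊓ q.2}
  top_mem := le_iSup₂_of_le (f := fun (q : P × N) (_ : q ∈ {q : P × N | (q.1 : A) ⊓ q.2 ≤ ⊤}) =>
    (q.1 : A) ⊓ q.2) ((⟨⊤, P.top_mem⟩ : P), (⟨⊤, N.top_mem⟩ : N)) le_top (by simp)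
  inf_mem {a b} ha hb := by
    refine (inf_le_inf ha hb).trans ?_
    rw [iSup₂_inf_eq]
    refine iSup₂_le fun p hp => ?_
    rw [inf_iSup₂_eq]
    refine iSup₂_le fun q hq => ?_
    have e : (p.1 : A) ⊓ p.2 ⊓ ((q.1 : A) ⊓ q.2) = ((p.1 ⊓ q.1 : P) : A) ⊓ ((p.2 ⊓ q.2 : N) : A) :=
      inf_inf_inf_comm _ _ _ _
    rw [e]
    refine le_iSup₂_of_le (f := fun (q : P × N) (_ : q ∈ {q : P × N | (q.1 : A) ⊓ q.2 ≤ a ⊓ b}) =>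
      (q.1 : A) ⊓ q.2) (p.1 ⊓ q.1, p.2 ⊓ q.2) ?_ le_rfl
    change ((p.1 ⊓ q.1 : P) : A) ⊓ ((p.2 ⊓ q.2 : N) : A) ≤ a ⊓ b
    rw [← e]
    exact inf_le_inf hp hq
  sSup_mem T hT := by
    refine sSup_le fun x hx => (hT hx).trans ?_
    exact biSup_mono fun q hq => le_trans hq (le_sSup hx)

theorem left_subset_joins (P N : Subframe A) : P.carrier ⊆ (joins P N).carrier := fun x hx =>
  le_iSup₂_of_le (f := fun (q : P × N) (_ : q ∈ {q : P × N | (q.1 : A) ⊓ q.2 ≤ x}) =>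
    (q.1 : A) ⊓ q.2) ((⟨x, hx⟩ : P), (⟨⊤, N.top_mem⟩ : N)) inf_le_left (by simp)

theorem right_subset_joins (P N : Subframe A) : N.carrier ⊆ (joins P N).carrier := fun x hx =>
  le_iSup₂_of_le (f := fun (q : P × N) (_ : q ∈ {q : P × N | (q.1 : A) ⊓ q.2 ≤ x}) =>
    (q.1 : A) ⊓ q.2) ((⟨⊤, P.top_mem⟩ : P), (⟨x, hx⟩ : N)) inf_le_right (by simp)

end Subframe

/-! ### Coproducts of frames -/

/-- The coproduct `A ⊕ B` of two frames, as the frame of lower sets of `A × B` that are closed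
under (possibly empty) joins in each variable separately. -/
structure FrameCoproduct (A B : Type u) [Order.Frame A] [Order.Frame B] where
  carrier : Set (A × B)
  lower : IsLowerSet carrier
  sSup_left : ∀ (S : Set A) (b : B), (∀ a ∈ S, (a, b) ∈ carrier) → (sSup S, b) ∈ carrier
  sSup_right : ∀ (a : A) (S : Set B), (∀ b ∈ S, (a, b) ∈ carrier) → (a, sSup S) ∈ carrier

namespace FrameCoproduct

variable {A B : Type u} {N : Type*} [Order.Frame A] [Order.Frame B] [Order.Frame N]

instance : PartialOrder (FrameCoproduct A B) :=
  PartialOrder.lift carrier fun I J h => by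
    cases I
    cases J
    cases h
    rfl

instance : InfSet (FrameCoproduct A B) where
  sInf 𝒮 :=
    { carrier := {p | ∀ I ∈ 𝒮, p ∈ I.carrier}
      lower := fun _ _ h hp I hI => I.lower h (hp I hI)
      sSup_left := fun S b h I hI => I.sSup_left S b fun a ha => h a ha I hI
      sSup_right := fun a S h I hI => I.sSup_right a S fun b hb => h b hb I hI }

instance : CompleteLattice (FrameCoproduct A B) where
  inf I J :=
    { carrier := I.carrier ∩ J.carrier
      lower := I.lower.inter J.lower
      sSup_left := fun S b h =>
        ⟨I.sSup_left S b fun a ha => (h a ha).1, J.sSup_left S b fun a ha => (h a ha).2⟩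
      sSup_right := fun a S h =>
        ⟨I.sSup_right a S fun b hb => (h b hb).1, J.sSup_right a S fun b hb => (h b hb).2⟩ }
  inf_le_left _ _ _ h := h.1
  inf_le_right _ _ _ h := h.2
  le_inf _ _ _ h h' _ hp := ⟨h hp, h' hp⟩
  __ := completeLatticeOfInf (FrameCoproduct A B) fun _ =>
    ⟨fun _ hI _ hp => hp _ hI, fun _ hJ _ hp _ hI => hJ hI hp⟩

/-- The relative pseudocomplement in the coproduct. -/
def imp (I J : FrameCoproduct A B) : FrameCoproduct A B where
  carrier := {p | ∀ q ≤ p, q ∈ I.carrier → q ∈ J.carrier}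
  lower _ _ h hp q hq := hp q (hq.trans h)
  sSup_left S b h := by
    rintro ⟨x, y⟩ ⟨hx, hy⟩ hI
    have e : sSup ((fun a => x ⊓ a) '' S) = x := by
      rw [sSup_image, ← inf_sSup_eq]
      exact inf_eq_left.2 hx
    rw [← e]
    refine J.sSup_left _ _ ?_
    rintro _ ⟨a, ha, rfl⟩
    exact h a ha _ ⟨inf_le_right, hy⟩ (I.lower (show (x ⊓ a, y) ≤ (x, y) from ⟨inf_le_left, le_rfl⟩) hI)
  sSup_right a S h := by
    rintro ⟨x, y⟩ ⟨hx, hy⟩ hI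
    have e : sSup ((fun b => y ⊓ b) '' S) = y := by
      rw [sSup_image, ← inf_sSup_eq]
      exact inf_eq_left.2 hy
    rw [← e]
    refine J.sSup_right _ _ ?_
    rintro _ ⟨b, hb, rfl⟩
    exact h b hb _ ⟨hx, inf_le_right⟩ (I.lower (show (x, y ⊓ b) ≤ (x, y) from ⟨le_rfl, inf_le_left⟩) hI)

instance : Order.Frame (FrameCoproduct A B) := .ofMinimalAxioms
  { inf_sSup_le_iSup_inf := fun I 𝒮 => by
      have h : sSup 𝒮 ≤ I.imp (⨆ J ∈ 𝒮, I ⊓ J) := sSup_le fun J hJ p hp q hq hI =>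
        (le_iSup₂_of_le J hJ le_rfl : I ⊓ J ≤ ⨆ J ∈ 𝒮, I ⊓ J) ⟨hI, J.lower hq hp⟩
      rintro p ⟨hI, hp⟩
      exact h hp p le_rfl hI }

theorem bot_left_mem (I : FrameCoproduct A B) (b : B) : ((⊥ : A), b) ∈ I.carrier := by
  simpa using I.sSup_left ∅ b (by simp)

theorem bot_right_mem (I : FrameCoproduct A B) (a : A) : (a, (⊥ : B)) ∈ I.carrier := by
  simpa using I.sSup_right a ∅ (by simp)

/-- The element `a ⊕ 1` of the coproduct. -/
def inlFun (a : A) : FrameCoproduct A B :=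
  { carrier := {p | p.1 ≤ a ∨ p.2 = ⊥}
    lower := by
      rintro p q h (hp | hp)
      · exact Or.inl (h.1.trans hp)
      · exact Or.inr (le_bot_iff.1 (h.2.trans hp.le))
    sSup_left := fun S b h => by
      by_cases hb : b = ⊥
      · exact Or.inr hb
      · exact Or.inl (sSup_le fun x hx => (h x hx).resolve_right hb)
    sSup_right := fun x S h => by
      by_cases hx : x ≤ a
      · exact Or.inl hx
      · exact Or.inr (sSup_eq_bot.2 fun b hb => (h b hb).resolve_left hx) }

/-- The first coproduct injection. -/
def inl : FrameHom A (FrameCoproduct A B) where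
  toFun := inlFun
  map_inf' a b := le_antisymm
    (fun _ hp => ⟨hp.imp_left fun h => h.trans inf_le_left,
      hp.imp_left fun h => h.trans inf_le_right⟩)
    (by
      rintro p ⟨hp | hp, hq | hq⟩
      · exact Or.inl (le_inf hp hq)
      · exact Or.inr hq
      · exact Or.inr hp
      · exact Or.inr hp)
  map_top' := top_le_iff.1 fun _ _ => Or.inl le_top
  map_sSup' S := by
    apply le_antisymm
    · rintro ⟨x, y⟩ (hp | hp)
      · refine lower _ (show (x, y) ≤ (sSup S, y) from ⟨hp, le_rfl⟩) (sSup_left _ S y fun a ha => ?_)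
        have := le_sSup (Set.mem_image_of_mem (inlFun (B := B)) ha)
        exact this (Or.inl le_rfl)
      · change y = ⊥ at hp
        subst hp
        exact bot_right_mem _ x
    · refine sSup_le ?_
      rintro _ ⟨a, ha, rfl⟩
      exact fun _ hp => hp.imp_left fun h => h.trans (le_sSup ha)

/-- The element `1 ⊕ b` of the coproduct. -/
def inrFun (b : B) : FrameCoproduct A B :=
  { carrier := {p | p.2 ≤ b ∨ p.1 = ⊥}
    lower := by
      rintro p q h (hp | hp)
      · exact Or.inl (h.2.trans hp)
      · exact Or.inr (le_bot_iff.1 (h.1.trans hp.le))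
    sSup_left := fun S y h => by
      by_cases hy : y ≤ b
      · exact Or.inl hy
      · exact Or.inr (sSup_eq_bot.2 fun a ha => (h a ha).resolve_left hy)
    sSup_right := fun x S h => by
      by_cases hx : x = ⊥
      · exact Or.inr hx
      · exact Or.inl (sSup_le fun y hy => (h y hy).resolve_right hx) }

/-- The second coproduct injection. -/
def inr : FrameHom B (FrameCoproduct A B) where
  toFun := inrFun
  map_inf' a b := le_antisymm
    (fun _ hp => ⟨hp.imp_left fun h => h.trans inf_le_left,
      hp.imp_left fun h => h.trans inf_le_right⟩)
    (by
      rintro p ⟨hp | hp, hq | hq⟩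
      · exact Or.inl (le_inf hp hq)
      · exact Or.inr hq
      · exact Or.inr hp
      · exact Or.inr hp)
  map_top' := top_le_iff.1 fun _ _ => Or.inl le_top
  map_sSup' S := by
    apply le_antisymm
    · rintro ⟨x, y⟩ (hp | hp)
      · refine lower _ (show (x, y) ≤ (x, sSup S) from ⟨le_rfl, hp⟩)
          (sSup_right _ x S fun b hb => ?_)
        have := le_sSup (Set.mem_image_of_mem (inrFun (A := A)) hb)
        exact this (Or.inl le_rfl)
      · change x = ⊥ at hp
        subst hp
        exact bot_left_mem _ y
    · refine sSup_le ?_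
      rintro _ ⟨b, hb, rfl⟩
      exact fun _ hp => hp.imp_left fun h => h.trans (le_sSup hb)

theorem inl_inf_inr_le_iff {a : A} {b : B} {I : FrameCoproduct A B} :
    inl a ⊓ inr b ≤ I ↔ (a, b) ∈ I.carrier := by
  constructor
  · intro h
    exact h ⟨Or.inl le_rfl, Or.inl le_rfl⟩
  · rintro h ⟨x, y⟩ ⟨hx, hy⟩
    rcases hx with hx | hx
    · rcases hy with hy | hy
      · exact I.lower ⟨hx, hy⟩ h
      · change x = ⊥ at hy
        subst hy
        exact bot_left_mem I y
    · change y = ⊥ at hx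
      subst hx
      exact bot_right_mem I x

theorem eq_iSup (I : FrameCoproduct A B) : I = ⨆ p ∈ I.carrier, inl p.1 ⊓ inr p.2 := by
  apply le_antisymm
  · intro p hp
    exact inl_inf_inr_le_iff.1 (le_iSup₂_of_le (f := fun (p : A × B) (_ : p ∈ I.carrier) =>
      inl p.1 ⊓ inr p.2) p hp le_rfl)
  · exact iSup₂_le fun p hp => inl_inf_inr_le_iff.2 hp

/-- The copairing of two frame homomorphisms. -/
def desc (f : FrameHom A N) (g : FrameHom B N) : FrameHom (FrameCoproduct A B) N where
  toFun I := ⨆ p ∈ I.carrier, f p.1 ⊓ g p.2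
  map_inf' I J := by
    apply le_antisymm
    · exact le_inf (biSup_mono fun _ h => h.1) (biSup_mono fun _ h => h.2)
    · rw [iSup₂_inf_eq]
      refine iSup₂_le fun p hp => ?_
      rw [inf_iSup₂_eq]
      refine iSup₂_le fun q hq => ?_
      rw [inf_inf_inf_comm, ← map_inf, ← map_inf]
      exact le_iSup₂_of_le (f := fun (p : A × B) (_ : p ∈ (I ⊓ J).carrier) => f p.1 ⊓ g p.2)
        (p ⊓ q) ⟨I.lower inf_le_left hp, J.lower inf_le_right hq⟩ le_rfl
  map_top' := top_le_iff.1 (le_iSup₂_of_le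
    (f := fun (p : A × B) (_ : p ∈ (⊤ : FrameCoproduct A B).carrier) => f p.1 ⊓ g p.2)
    (⊤, ⊤) ((le_top : inl ⊤ ≤ ⊤) (Or.inl le_rfl)) (by simp))
  map_sSup' 𝒮 := by
    apply le_antisymm
    · set c : N := sSup ((fun I : FrameCoproduct A B => ⨆ p ∈ I.carrier, f p.1 ⊓ g p.2) '' 𝒮)
      let K : FrameCoproduct A B :=
        { carrier := {p | f p.1 ⊓ g p.2 ≤ c}
          lower := fun p q h hp =>
            (inf_le_inf (OrderHomClass.mono f h.1) (OrderHomClass.mono g h.2)).trans hp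
          sSup_left := fun S b h => by
            change f (sSup S) ⊓ g b ≤ c
            rw [map_sSup, sSup_inf_eq]
            refine iSup₂_le ?_
            rintro _ ⟨a, ha, rfl⟩
            exact h a ha
          sSup_right := fun a S h => by
            change f a ⊓ g (sSup S) ≤ c
            rw [map_sSup, inf_sSup_eq]
            refine iSup₂_le ?_
            rintro _ ⟨b, hb, rfl⟩
            exact h b hb }
      have hK : sSup 𝒮 ≤ K := sSup_le fun I hI p hp =>
        le_trans (le_iSup₂_of_le (f := fun (p : A × B) (_ : p ∈ I.carrier) => f p.1 ⊓ g p.2)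
          p hp le_rfl) (le_sSup (Set.mem_image_of_mem _ hI))
      exact iSup₂_le fun p hp => hK hp
    · refine sSup_le ?_
      rintro _ ⟨I, hI, rfl⟩
      exact biSup_mono fun p hp => (le_sSup hI : I ≤ sSup 𝒮) hp

theorem desc_inl (f : FrameHom A N) (g : FrameHom B N) (a : A) : desc f g (inl a) = f a := by
  apply le_antisymm
  · refine iSup₂_le ?_
    rintro ⟨x, y⟩ (h | h)
    · exact inf_le_left.trans (OrderHomClass.mono f h)
    · change y = ⊥ at h
      subst h
      simp
  · exact le_iSup₂_of_le (f := fun (p : A × B) (_ : p ∈ (inl a).carrier) => f p.1 ⊓ g p.2)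
      (a, ⊤) (Or.inl le_rfl) (by simp)

theorem desc_inr (f : FrameHom A N) (g : FrameHom B N) (b : B) : desc f g (inr b) = g b := by
  apply le_antisymm
  · refine iSup₂_le ?_
    rintro ⟨x, y⟩ (h | h)
    · exact inf_le_right.trans (OrderHomClass.mono g h)
    · change x = ⊥ at h
      subst h
      simp
  · exact le_iSup₂_of_le (f := fun (p : A × B) (_ : p ∈ (inr b).carrier) => f p.1 ⊓ g p.2)
      (⊤, b) (Or.inl le_rfl) (by simp)

end FrameCoproduct

/-! ### Biframes -/

/-- A biframe `(L⁺, L⁻, L)`: two frames embedded in a main frame `L`, every element of which is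
a join of binary meets of an element of `L⁺` and an element of `L⁻`. -/
structure Biframe where
  Pos : Type u
  Neg : Type u
  Main : Type u
  [framePos : Order.Frame Pos]
  [frameNeg : Order.Frame Neg]
  [frameMain : Order.Frame Main]
  incPos : FrameHom Pos Main
  incNeg : FrameHom Neg Main
  incPos_injective : Function.Injective incPos
  incNeg_injective : Function.Injective incNeg
  generated : ∀ x : Main, ∃ S : Set (Pos × Neg), x = ⨆ p ∈ S, incPos p.1 ⊓ incNeg p.2

attribute [instance] Biframe.framePos Biframe.frameNeg Biframe.frameMain

/-- The finitary elements of a frame `M` with respect to two maps `i : A → M` and `j : B → M`: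
finite joins of binary meets of generators. -/
def finitaryElements {A B M : Type u} [Order.Frame A] [Order.Frame B] [Order.Frame M]
    (i : FrameHom A M) (j : FrameHom B M) : Set M :=
  {x | ∃ s : Finset (A × B), x = s.sup fun p => i p.1 ⊓ j p.2}

/-- A congruence on `M` is finitary if it is generated by a relation between finitary elements.
As the finitary elements are closed under binary meets, it does not matter whether the generating
pairs are read as equalities or as inequalities. -/
def FrameCongruence.IsFinitary {A B M : Type u} [Order.Frame A] [Order.Frame B] [Order.Frame M]
    (i : FrameHom A M) (j : FrameHom B M) (C : FrameCongruence M) : Prop :=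
  ∃ R : Set (M × M), R ⊆ finitaryElements i j ×ˢ finitaryElements i j ∧
    C = FrameCongruence.generate R

namespace Biframe

open FrameCongruence

/-- A biframe is finitary if its main component is canonically isomorphic to the quotient of the
coproduct `L⁺ ⊕ L⁻` by a finitary congruence. -/
def IsFinitary (L : Biframe.{u}) : Prop :=
  ∃ C : FrameCongruence (FrameCoproduct L.Pos L.Neg),
    C.IsFinitary FrameCoproduct.inl FrameCoproduct.inr ∧
    ∃ e : C.QFrame ≃o L.Main,
      (∀ a, e (QFrame.mk C (FrameCoproduct.inl a)) = L.incPos a) ∧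
      ∀ b, e (QFrame.mk C (FrameCoproduct.inr b)) = L.incNeg b

/-- A biframe morphism: a pair of frame homomorphisms for which a compatible frame homomorphism
between the main components exists. -/
@[ext]
structure Hom (L : Biframe.{u}) (M : Biframe.{v}) where
  pos : FrameHom L.Pos M.Pos
  neg : FrameHom L.Neg M.Neg
  exists_main : ∃ f : FrameHom L.Main M.Main,
    (∀ a, f (L.incPos a) = M.incPos (pos a)) ∧ ∀ b, f (L.incNeg b) = M.incNeg (neg b)

/-- Composition of biframe morphisms, in diagrammatic order. -/
def Hom.comp {L : Biframe.{u}} {M : Biframe.{v}} {N : Biframe.{w}} (h : Hom L M) (k : Hom M N) :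
    Hom L N where
  pos := k.pos.comp h.pos
  neg := k.neg.comp h.neg
  exists_main := by
    obtain ⟨f, hf, hf'⟩ := h.exists_main
    obtain ⟨g, hg, hg'⟩ := k.exists_main
    refine ⟨g.comp f, fun a => ?_, fun b => ?_⟩
    · rw [FrameHom.comp_apply, FrameHom.comp_apply, hf, hg]
    · rw [FrameHom.comp_apply, FrameHom.comp_apply, hf', hg']

/-- An isomorphism of biframes. -/
structure Iso (L : Biframe.{u}) (M : Biframe.{v}) where
  pos : L.Pos ≃o M.Pos
  neg : L.Neg ≃o M.Neg
  main : L.Main ≃o M.Main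
  main_incPos : ∀ a, main (L.incPos a) = M.incPos (pos a)
  main_incNeg : ∀ b, main (L.incNeg b) = M.incNeg (neg b)

/-- The biframe `(2, 2, 2)`, where `2` is the frame of truth values. -/
abbrev two : Biframe.{0} where
  Pos := Prop
  Neg := Prop
  Main := Prop
  incPos := FrameHom.id Prop
  incNeg := FrameHom.id Prop
  incPos_injective := Function.injective_id
  incNeg_injective := Function.injective_id
  generated x := ⟨{(x, ⊤)}, by simp⟩

/-- The quotient `(L⁺/C⁺, L⁻/C⁻, L/C)` of a biframe by a congruence `C` on its main component. -/
def quotient (L : Biframe.{u}) (C : FrameCongruence L.Main) : Biframe.{u} where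
  Pos := (C.comap L.incPos).QFrame
  Neg := (C.comap L.incNeg).QFrame
  Main := C.QFrame
  incPos := QFrame.lift ((QFrame.mk C).comp L.incPos) fun _ _ h => QFrame.mk_eq_mk.2 h
  incNeg := QFrame.lift ((QFrame.mk C).comp L.incNeg) fun _ _ h => QFrame.mk_eq_mk.2 h
  incPos_injective p q h := by
    obtain ⟨x, rfl⟩ := QFrame.mk_surjective p
    obtain ⟨y, rfl⟩ := QFrame.mk_surjective q
    have h' : QFrame.mk C (L.incPos x) = QFrame.mk C (L.incPos y) := h
    have h'' : (C.comap L.incPos).r x y := QFrame.mk_eq_mk (C := C).1 h'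
    exact QFrame.mk_eq_mk.2 h''
  incNeg_injective p q h := by
    obtain ⟨x, rfl⟩ := QFrame.mk_surjective p
    obtain ⟨y, rfl⟩ := QFrame.mk_surjective q
    have h' : QFrame.mk C (L.incNeg x) = QFrame.mk C (L.incNeg y) := h
    have h'' : (C.comap L.incNeg).r x y := QFrame.mk_eq_mk (C := C).1 h'
    exact QFrame.mk_eq_mk.2 h''
  generated q := by
    obtain ⟨x, rfl⟩ := QFrame.mk_surjective q
    obtain ⟨S, hS⟩ := L.generated x
    refine ⟨(fun p : L.Pos × L.Neg => (QFrame.mk (C.comap L.incPos) p.1,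
      QFrame.mk (C.comap L.incNeg) p.2)) '' S, ?_⟩
    rw [iSup_image]
    conv_lhs => rw [hS]
    simp only [map_iSup, map_inf]
    rfl

/-- The quotient map `L → L/C`. -/
def quotientMap (L : Biframe.{u}) (C : FrameCongruence L.Main) : Hom L (L.quotient C) where
  pos := QFrame.mk (C.comap L.incPos)
  neg := QFrame.mk (C.comap L.incNeg)
  exists_main := ⟨QFrame.mk C, fun _ => rfl, fun _ => rfl⟩

/-! ### The assembly of a biframe -/

/-- The finitary assembly: the subframe of the assembly of `L` generated by all closed congruences
and by the open congruences of finitary elements. -/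
def finAssembly (L : Biframe.{u}) : Subframe (FrameCongruence L.Main) :=
  Subframe.closure (Set.range nabla ∪ delta '' finitaryElements L.incPos L.incNeg)

/-- The subframe generated by the `∇(a⁺)` and the `Δ(a⁻)`. -/
def posAssembly (L : Biframe.{u}) : Subframe (FrameCongruence L.Main) :=
  Subframe.closure ((Set.range fun a => nabla (L.incPos a)) ∪
    Set.range fun b => delta (L.incNeg b))

/-- The subframe generated by the `∇(a⁻)` and the `Δ(a⁺)`. -/
def negAssembly (L : Biframe.{u}) : Subframe (FrameCongruence L.Main) :=
  Subframe.closure ((Set.range fun b => nabla (L.incNeg b)) ∪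
    Set.range fun a => delta (L.incPos a))

theorem incPos_mem_finitaryElements (L : Biframe.{u}) (a : L.Pos) :
    L.incPos a ∈ finitaryElements L.incPos L.incNeg := ⟨{(a, ⊤)}, by simp⟩

theorem incNeg_mem_finitaryElements (L : Biframe.{u}) (b : L.Neg) :
    L.incNeg b ∈ finitaryElements L.incPos L.incNeg := ⟨{(⊤, b)}, by simp⟩

theorem posAssembly_subset (L : Biframe.{u}) :
    L.posAssembly.carrier ⊆ L.finAssembly.carrier := by
  refine Subframe.closure_subset ?_
  rintro _ (⟨a, rfl⟩ | ⟨b, rfl⟩)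
  · exact Subframe.subset_closure _ (Or.inl ⟨_, rfl⟩)
  · exact Subframe.subset_closure _ (Or.inr ⟨_, L.incNeg_mem_finitaryElements b, rfl⟩)

theorem negAssembly_subset (L : Biframe.{u}) :
    L.negAssembly.carrier ⊆ L.finAssembly.carrier := by
  refine Subframe.closure_subset ?_
  rintro _ (⟨b, rfl⟩ | ⟨a, rfl⟩)
  · exact Subframe.subset_closure _ (Or.inl ⟨_, rfl⟩)
  · exact Subframe.subset_closure _ (Or.inr ⟨_, L.incPos_mem_finitaryElements a, rfl⟩)

theorem finAssembly_subset_joins (L : Biframe.{u}) :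
    L.finAssembly.carrier ⊆ (Subframe.joins L.posAssembly L.negAssembly).carrier := by
  set J := Subframe.joins L.posAssembly L.negAssembly
  have hP := Subframe.left_subset_joins L.posAssembly L.negAssembly
  have hN := Subframe.right_subset_joins L.posAssembly L.negAssembly
  have iSup_mem {ι : Type u} (f : ι → FrameCongruence L.Main) (h : ∀ i, f i ∈ J.carrier) :
      (⨆ i, f i) ∈ J.carrier := J.sSup_mem _ (by
    rintro _ ⟨i, rfl⟩
    exact h i)
  have sup_mem {C D : FrameCongruence L.Main} (hC : C ∈ J.carrier) (hD : D ∈ J.carrier) :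
      C ⊔ D ∈ J.carrier := by
    rw [← sSup_pair]
    refine J.sSup_mem _ ?_
    rintro _ (rfl | rfl)
    · exact hC
    · exact hD
  refine Subframe.closure_subset ?_
  rintro _ (⟨x, rfl⟩ | ⟨x, ⟨s, rfl⟩, rfl⟩)
  · obtain ⟨S, rfl⟩ := L.generated x
    change nablaHom _ ∈ _
    rw [iSup_subtype', map_iSup]
    refine iSup_mem _ fun p => ?_
    rw [map_inf]
    exact J.inf_mem (hP (Subframe.subset_closure _ (Or.inl ⟨_, rfl⟩)))
      (hN (Subframe.subset_closure _ (Or.inl ⟨_, rfl⟩)))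
  · classical
    induction s using Finset.induction_on with
    | empty =>
      rw [Finset.sup_empty, delta_bot]
      exact J.top_mem
    | insert p s _ ih =>
      rw [Finset.sup_insert, delta_sup, delta_inf]
      exact J.inf_mem (sup_mem (hN (Subframe.subset_closure _ (Or.inr ⟨_, rfl⟩)))
        (hP (Subframe.subset_closure _ (Or.inr ⟨_, rfl⟩)))) ih

/-- The assembly of a biframe. -/
def assembly (L : Biframe.{u}) : Biframe.{u} where
  Pos := L.posAssembly
  Neg := L.negAssembly
  Main := L.finAssembly
  incPos := Subframe.inclusion L.posAssembly_subset
  incNeg := Subframe.inclusion L.negAssembly_subset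
  incPos_injective _ _ h :=
    Subtype.ext (congrArg (fun x : L.finAssembly => (x : FrameCongruence L.Main)) h)
  incNeg_injective _ _ h :=
    Subtype.ext (congrArg (fun x : L.finAssembly => (x : FrameCongruence L.Main)) h)
  generated x := by
    refine ⟨{q | (q.1 : FrameCongruence L.Main) ⊓ q.2 ≤ x}, le_antisymm ?_ ?_⟩
    · have h := L.finAssembly_subset_joins x.2
      refine Subtype.coe_le_coe.1 (le_trans h (iSup₂_le fun q hq => ?_))
      exact Subtype.coe_le_coe.2 (le_iSup₂_of_le
        (f := fun (q : L.posAssembly × L.negAssembly)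
          (_ : q ∈ {q | (q.1 : FrameCongruence L.Main) ⊓ q.2 ≤ x}) =>
          Subframe.inclusion L.posAssembly_subset q.1 ⊓
            Subframe.inclusion L.negAssembly_subset q.2) q hq le_rfl)
    · exact iSup₂_le fun q hq => Subtype.coe_le_coe.1 hq

/-- The canonical morphism `∇ : L → A(L)`. -/
def nablaMap (L : Biframe.{u}) : Hom L L.assembly where
  pos := Subframe.codRestrict (nablaHom.comp L.incPos) L.posAssembly fun _ =>
    Subframe.subset_closure _ (Or.inl ⟨_, rfl⟩)
  neg := Subframe.codRestrict (nablaHom.comp L.incNeg) L.negAssembly fun _ =>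
    Subframe.subset_closure _ (Or.inl ⟨_, rfl⟩)
  exists_main := ⟨Subframe.codRestrict nablaHom L.finAssembly fun _ =>
    Subframe.subset_closure _ (Or.inl ⟨_, rfl⟩), fun _ => rfl, fun _ => rfl⟩

end Biframe

/-! ### Bispaces -/

/-- A bitopological space. -/
structure Bispace where
  carrier : Type u
  pos : TopologicalSpace carrier
  neg : TopologicalSpace carrier

namespace Bispace

open Topology

instance : CoeSort Bispace.{u} (Type u) := ⟨carrier⟩

/-- The frame of positive opens. -/
abbrev OpensPos (X : Bispace.{u}) : Type u := @TopologicalSpace.Opens X X.pos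

/-- The frame of negative opens. -/
abbrev OpensNeg (X : Bispace.{u}) : Type u := @TopologicalSpace.Opens X X.neg

/-- A bihomeomorphism: a bijection that is bicontinuous with bicontinuous inverse. -/
structure Bihomeo (X : Bispace.{u}) (Y : Bispace.{v}) extends X ≃ Y where
  continuous_pos : Continuous[X.pos, Y.pos] toFun
  continuous_neg : Continuous[X.neg, Y.neg] toFun
  continuous_inv_pos : Continuous[Y.pos, X.pos] invFun
  continuous_inv_neg : Continuous[Y.neg, X.neg] invFun

/-- The patch topology, generated by the positive and the negative opens. -/
abbrev patch (X : Bispace.{u}) : TopologicalSpace X :=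
  TopologicalSpace.generateFrom ({U | IsOpen[X.pos] U} ∪ {U | IsOpen[X.neg] U})

/-- Every set is open in the patch topology. -/
def IsPatchDiscrete (X : Bispace.{u}) : Prop := ∀ U : Set X, IsOpen[X.patch] U

/-- The Skula bispace: the positive topology is generated by the positive opens and the negative
closed sets, the negative topology by the negative opens and the positive closed sets. -/
def skula (X : Bispace.{u}) : Bispace.{u} where
  carrier := X
  pos := TopologicalSpace.generateFrom ({U | IsOpen[X.pos] U} ∪ {F | IsClosed[X.neg] F})
  neg := TopologicalSpace.generateFrom ({U | IsOpen[X.neg] U} ∪ {F | IsClosed[X.pos] F})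

/-- The bi-`T_D` axiom: every singleton is of the form `U⁺ ∩ U⁻ ∩ (V⁺)ᶜ ∩ (V⁻)ᶜ`. -/
def IsBiTD (X : Bispace.{u}) : Prop :=
  ∀ x : X, ∃ U V U' V' : Set X, IsOpen[X.pos] U ∧ IsOpen[X.neg] V ∧ IsOpen[X.pos] U' ∧
    IsOpen[X.neg] V' ∧ ({x} : Set X) = U ∩ V ∩ U'ᶜ ∩ V'ᶜ

/-- The bisubspace on a subset, with the two subspace topologies. -/
def subspace (X : Bispace.{u}) (Y : Set X) : Bispace.{u} where
  carrier := Y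
  pos := X.pos.induced Subtype.val
  neg := X.neg.induced Subtype.val

/-- The relation on `Ω⁺(X) ⊕ Ω⁻(X)` of all pairs `(U⁺ ∧ U⁻, V⁺ ∨ V⁻)` with
`U⁺ ∩ U⁻ ⊆ V⁺ ∪ V⁻` in `X`. -/
def finRel (X : Bispace.{u}) :
    Set (FrameCoproduct X.OpensPos X.OpensNeg × FrameCoproduct X.OpensPos X.OpensNeg) :=
  {p | ∃ (U U' : X.OpensPos) (V V' : X.OpensNeg),
    (U : Set X) ∩ (V : Set X) ⊆ (U' : Set X) ∪ (V' : Set X) ∧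
    p = (FrameCoproduct.inl U ⊓ FrameCoproduct.inr V,
      FrameCoproduct.inl U' ⊔ FrameCoproduct.inr V')}

/-- The positive neighbourhood map of a point. -/
def nbhdPos (X : Bispace.{u}) (x : X) : FrameHom X.OpensPos Prop where
  toFun U := x ∈ (U : Set X)
  map_inf' _ _ := rfl
  map_top' := rfl
  map_sSup' S := by
    let _ := X.pos
    apply propext
    simp [sSup_image]

/-- The negative neighbourhood map of a point. -/
def nbhdNeg (X : Bispace.{u}) (x : X) : FrameHom X.OpensNeg Prop where
  toFun U := x ∈ (U : Set X)
  map_inf' _ _ := rfl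
  map_top' := rfl
  map_sSup' S := by
    let _ := X.neg
    apply propext
    simp [sSup_image]

/-- The common extension of the two neighbourhood maps of a point. -/
def nbhdMain (X : Bispace.{u}) (x : X) :
    FrameHom (FrameCongruence.generate X.finRel).QFrame Prop :=
  FrameCongruence.QFrame.lift (FrameCoproduct.desc (X.nbhdPos x) (X.nbhdNeg x))
    (FrameCongruence.generate_le_ker _ _ (by
      rintro _ ⟨U, U', V, V', h, rfl⟩
      rw [map_inf, map_sup, FrameCoproduct.desc_inl, FrameCoproduct.desc_inr,
        FrameCoproduct.desc_inl, FrameCoproduct.desc_inr]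
      exact fun hx => h hx))

theorem nbhdMain_inl (X : Bispace.{u}) (x : X) (U : X.OpensPos) :
    X.nbhdMain x (FrameCongruence.QFrame.mk _ (FrameCoproduct.inl U)) = X.nbhdPos x U :=
  FrameCoproduct.desc_inl _ _ _

theorem nbhdMain_inr (X : Bispace.{u}) (x : X) (V : X.OpensNeg) :
    X.nbhdMain x (FrameCongruence.QFrame.mk _ (FrameCoproduct.inr V)) = X.nbhdNeg x V :=
  FrameCoproduct.desc_inr _ _ _

/-- The finitary biframe of opens of a bispace. -/
def finOpens (X : Bispace.{u}) : Biframe.{u} where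
  Pos := X.OpensPos
  Neg := X.OpensNeg
  Main := (FrameCongruence.generate X.finRel).QFrame
  incPos := (FrameCongruence.QFrame.mk _).comp FrameCoproduct.inl
  incNeg := (FrameCongruence.QFrame.mk _).comp FrameCoproduct.inr
  incPos_injective U V h := by
    refine SetLike.coe_injective (Set.ext fun x => ?_)
    have := congrArg (X.nbhdMain x) h
    rw [FrameHom.comp_apply, FrameHom.comp_apply, nbhdMain_inl, nbhdMain_inl] at this
    exact iff_of_eq this
  incNeg_injective U V h := by
    refine SetLike.coe_injective (Set.ext fun x => ?_)
    have := congrArg (X.nbhdMain x) h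
    rw [FrameHom.comp_apply, FrameHom.comp_apply, nbhdMain_inr, nbhdMain_inr] at this
    exact iff_of_eq this
  generated q := by
    obtain ⟨I, rfl⟩ := FrameCongruence.QFrame.mk_surjective q
    refine ⟨I.carrier, ?_⟩
    conv_lhs => rw [I.eq_iSup]
    simp only [map_iSup, map_inf]
    rfl

end Bispace

/-! ### The bispectrum -/

namespace Biframe

open Topology

/-- The bispectrum of a biframe: the points are the morphisms to `(2, 2, 2)`, and the positive
(negative) opens are the sets of all points `f` with `f⁺(a) = 1` (with `f⁻(b) = 1`). -/
def bpt (L : Biframe.{u}) : Bispace.{u} where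
  carrier := Hom L two
  pos :=
    { IsOpen := fun U => ∃ a : L.Pos, U = {f : Hom L two | f.pos a}
      isOpen_univ := ⟨⊤, by
        ext f
        simp⟩
      isOpen_inter := by
        rintro _ _ ⟨a, rfl⟩ ⟨b, rfl⟩
        refine ⟨a ⊓ b, ?_⟩
        ext f
        simp
      isOpen_sUnion := by
        intro S hS
        refine ⟨sSup {a | {f : Hom L two | f.pos a} ∈ S}, ?_⟩
        ext f
        simp only [Set.mem_sUnion, Set.mem_ofPred_eq, map_sSup, sSup_Prop_eq, Set.mem_image]
        constructor
        · rintro ⟨U, hU, hf⟩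
          obtain ⟨a, rfl⟩ := hS U hU
          exact ⟨_, ⟨a, hU, rfl⟩, hf⟩
        · rintro ⟨_, ⟨a, ha, rfl⟩, hf⟩
          exact ⟨_, ha, hf⟩ }
  neg :=
    { IsOpen := fun U => ∃ b : L.Neg, U = {f : Hom L two | f.neg b}
      isOpen_univ := ⟨⊤, by
        ext f
        simp⟩
      isOpen_inter := by
        rintro _ _ ⟨a, rfl⟩ ⟨b, rfl⟩
        refine ⟨a ⊓ b, ?_⟩
        ext f
        simp
      isOpen_sUnion := by
        intro S hS
        refine ⟨sSup {a | {f : Hom L two | f.neg a} ∈ S}, ?_⟩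
        ext f
        simp only [Set.mem_sUnion, Set.mem_ofPred_eq, map_sSup, sSup_Prop_eq, Set.mem_image]
        constructor
        · rintro ⟨U, hU, hf⟩
          obtain ⟨a, rfl⟩ := hS U hU
          exact ⟨_, ⟨a, hU, rfl⟩, hf⟩
        · rintro ⟨_, ⟨a, ha, rfl⟩, hf⟩
          exact ⟨_, ha, hf⟩ }

/-- The map of bispectra induced by a biframe morphism, by precomposition. -/
def bptMap {L M : Biframe.{u}} (h : Hom L M) : M.bpt → L.bpt := fun f => h.comp f

/-- The set of points `f` with `f⁺(a) = 1`, as a positive open. -/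
def phiPos (L : Biframe.{u}) (a : L.Pos) : L.bpt.OpensPos :=
  @TopologicalSpace.Opens.mk L.bpt L.bpt.pos {f : Hom L two | f.pos a} ⟨a, rfl⟩

/-- The set of points `f` with `f⁻(b) = 1`, as a negative open. -/
def phiNeg (L : Biframe.{u}) (b : L.Neg) : L.bpt.OpensNeg :=
  @TopologicalSpace.Opens.mk L.bpt L.bpt.neg {f : Hom L two | f.neg b} ⟨b, rfl⟩

/-- A finitary biframe is bispatial if the pair `(φ⁺, φ⁻)` is an isomorphism from it to the
finitary biframe of opens of its bispectrum. -/
def IsBispatial (L : Biframe.{u}) : Prop :=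
  ∃ e : Iso L L.bpt.finOpens, (∀ a, e.pos a = L.phiPos a) ∧ ∀ b, e.neg b = L.phiNeg b

end Biframe

namespace Bispace

/-- The unit `ψ`, which maps a point to its pair of neighbourhood maps. -/
def psi (X : Bispace.{u}) (x : X) : X.finOpens.bpt :=
  (⟨X.nbhdPos x, X.nbhdNeg x, X.nbhdMain x, X.nbhdMain_inl x, X.nbhdMain_inr x⟩ :
    Biframe.Hom X.finOpens Biframe.two)

/-- A bispace is bisober if the unit `ψ` is a bihomeomorphism. -/
def IsBisober (X : Bispace.{u}) : Prop :=
  ∃ h : Bihomeo X X.finOpens.bpt, ∀ x, h.toEquiv x = X.psi x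

end Bispace

/-! ### Biquotients -/

namespace Biframe

/-- A biquotient `L/C` of a finitary biframe, given by a finitary congruence `C` on the main
component. -/
@[ext]
structure Biquotient (L : Biframe.{u}) where
  cong : FrameCongruence L.Main
  isFinitary : cong.IsFinitary L.incPos L.incNeg

/-- The order of `S(L)`: `L/C ≤ L/D` if and only if `D ⊆ C`. -/
instance (L : Biframe.{u}) : PartialOrder L.Biquotient where
  le Q Q' := Q'.cong ≤ Q.cong
  le_refl Q := le_refl Q.cong
  le_trans _ _ _ h h' := le_trans h' h
  le_antisymm _ _ h h' := Biquotient.ext (le_antisymm h' h)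

/-- The underlying biframe of a biquotient. -/
def Biquotient.toBiframe {L : Biframe.{u}} (Q : L.Biquotient) : Biframe.{u} := L.quotient Q.cong

/-- The bisubspace of `bpt(L)` given by a biquotient `q : L → L/C`: the image of
`bpt(q) : bpt(L/C) → bpt(L)`. -/
def Biquotient.points {L : Biframe.{u}} (Q : L.Biquotient) : Set L.bpt :=
  Set.range (bptMap (L.quotientMap Q.cong))

/-- The ordered collection `bisp[S(L)]` of bispatial biquotients. -/
def BispatialBiquotient (L : Biframe.{u}) : Type u :=
  {Q : L.Biquotient // Q.toBiframe.IsBispatial}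

instance (L : Biframe.{u}) : PartialOrder L.BispatialBiquotient :=
  inferInstanceAs (PartialOrder {Q : L.Biquotient // Q.toBiframe.IsBispatial})

end Biframe

/-- A partially ordered set is a coframe. -/
def IsCoframeOrder (P : Type u) [PartialOrder P] : Prop :=
  ∃ (Q : Type u) (_ : Order.Coframe Q), Nonempty (P ≃o Q)

/-- A partially ordered set is a Boolean algebra. -/
def IsBooleanOrder (P : Type u) [PartialOrder P] : Prop :=
  ∃ (Q : Type u) (_ : BooleanAlgebra Q), Nonempty (P ≃o Q)

/-!
Everything rests on the *basic inequalities* `a⁺ ⊓ a⁻ ≤ b⁺ ⊔ b⁻` between generators. By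
distributivity an inequality between finitary elements is equivalent to finitely many basic ones
(`FrameCongruence.map_le_map_of_basic`), so a finitary congruence is determined by the basic
inequalities that hold in its quotient. Hence a finitary biframe, each of its biquotients, and the
biframe `Ω_fin(X)` of a bispace are all presented by basic inequalities (`Biframe.IsPresented`):
homomorphisms out of the main component are pairs of homomorphisms on the generating frames that
respect the valid basic inequalities.

Points satisfy or refute basic inequalities, which yields a Galois connection between sets `Y` of
points and biquotients `Q`. On the side of biquotients, `Q` is bispatial exactly when every basic
inequality valid on its points holds in it (`Biframe.Biquotient.isBispatial_iff`). On the side of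
sets of points, `Y` is bisober exactly when it contains every point that satisfies all the basic
inequalities valid on `Y` (`Biframe.subspace_isBisober_iff`), because such points are the points of
`Ω_fin(Y)`. The Galois connection therefore restricts to an order isomorphism between bispatial
biquotients and bisober bisubspaces (`Biframe.bispatialEquiv`).

The set of points refuting a basic inequality has the form `U⁺ ∩ U⁻ ∩ (V⁺)ᶜ ∩ (V⁻)ᶜ`, and these
sets form a basis of the patch of the Skula bispace (`Bispace.isOpen_skula_patch_iff`). The bisober
bisubspaces are therefore the closed sets of that topology (`Biframe.hull_eq_self_iff`), which form
a coframe. The listed conditions all say that this topology is discrete: bi-`T_D` says that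
singletons are basic open sets, and as singletons are closed (`Biframe.hull_singleton`), the lattice
of closed sets is Boolean only if they are also open.

Finally, the kernel of a point `f` of a frame is a prime element of its frame of congruences
(`FrameCongruence.assemblyPoint`). This gives the point `α(f)` of the assembly; conversely a point
of the assembly is determined by its restriction along `∇`, because `Δ(a)` is the complement of
`∇(a)`.
-/

/-! ### Basic inequalities and finitary congruences -/

namespace FrameCongruence

variable {A B M : Type u} [Order.Frame A] [Order.Frame B] [Order.Frame M]

theorem QFrame.mk_le_mk {C : FrameCongruence M} {x y : M} :
    QFrame.mk C x ≤ QFrame.mk C y ↔ C.r (x ⊓ y) x := by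
  rw [← inf_eq_left, ← map_inf, QFrame.mk_eq_mk]

theorem generate_le_iff {R : Set (M × M)} {C : FrameCongruence M} :
    generate R ≤ C ↔ ∀ p ∈ R, QFrame.mk C p.1 ≤ QFrame.mk C p.2 := by
  simp only [QFrame.mk_le_mk]
  exact ⟨fun h p hp => h _ _ fun D hD => hD p hp, fun h => sInf_le h⟩

theorem mk_le_mk_of_mem {R : Set (M × M)} {p : M × M} (hp : p ∈ R) :
    QFrame.mk (generate R) p.1 ≤ QFrame.mk (generate R) p.2 :=
  generate_le_iff.1 le_rfl p hp

theorem ker_mk (C : FrameCongruence M) : ker (QFrame.mk C) = C :=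
  r_ext fun _ _ => QFrame.mk_eq_mk

variable {K : Type v} {N : Type w} [Order.Frame K] [Order.Frame N]
  {i : FrameHom A M} {j : FrameHom B M}

/-- Inequalities between finitary elements are controlled by the basic ones. The left-hand side
splits into its joinands; on the right-hand side, each joinand `i a ⊓ j b` is removed by
distributivity, which replaces the inequality by two with `i a` or `j b` in its place. -/
theorem map_le_map_of_basic {k : FrameHom M K} {h : FrameHom M N}
    (hs : ∀ a b a' b', k (i a) ⊓ k (j b) ≤ k (i a') ⊔ k (j b') →
      h (i a) ⊓ h (j b) ≤ h (i a') ⊔ h (j b'))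
    {x y : M} (hx : x ∈ finitaryElements i j) (hy : y ∈ finitaryElements i j)
    (hxy : k x ≤ k y) : h x ≤ h y := by
  classical
  obtain ⟨s, rfl⟩ := hx
  obtain ⟨t, rfl⟩ := hy
  have key (a : A) (b : B) (t : Finset (A × B)) : ∀ (a' : A) (b' : B),
      k (i a) ⊓ k (j b) ≤ k (i a') ⊔ k (j b') ⊔ k (t.sup fun p => i p.1 ⊓ j p.2) →
      h (i a) ⊓ h (j b) ≤ h (i a') ⊔ h (j b') ⊔ h (t.sup fun p => i p.1 ⊓ j p.2) := by
    induction t using Finset.induction_on with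
    | empty =>
      intro a' b' H
      simp only [Finset.sup_empty, map_bot, sup_bot_eq] at H ⊢
      exact hs _ _ _ _ H
    | insert p t _ ih =>
      intro a' b' H
      rw [Finset.sup_insert, map_sup, map_inf] at H ⊢
      have h1 := ih (a' ⊔ p.1) b' (H.trans (by
        rw [map_sup, map_sup]
        refine sup_le (sup_le ?_ ?_) (sup_le ?_ le_sup_right)
        · exact le_sup_of_le_left (le_sup_of_le_left le_sup_left)
        · exact le_sup_of_le_left le_sup_right
        · exact inf_le_left.trans (le_sup_of_le_left (le_sup_of_le_left le_sup_right))))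
      have h2 := ih a' (b' ⊔ p.2) (H.trans (by
        rw [map_sup, map_sup]
        refine sup_le (sup_le ?_ ?_) (sup_le ?_ le_sup_right)
        · exact le_sup_of_le_left le_sup_left
        · exact le_sup_of_le_left (le_sup_of_le_right le_sup_left)
        · exact inf_le_right.trans (le_sup_of_le_left (le_sup_of_le_right le_sup_right))))
      refine (le_inf h1 h2).trans ?_
      rw [map_sup, map_sup, map_sup, map_sup]
      set α := h (i a')
      set β := h (j b')
      set c := h (t.sup fun p => i p.1 ⊓ j p.2)
      have e1 : α ⊔ h (i p.1) ⊔ β ⊔ c = (α ⊔ β ⊔ c) ⊔ h (i p.1) := by ac_rfl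
      have e2 : α ⊔ (β ⊔ h (j p.2)) ⊔ c = (α ⊔ β ⊔ c) ⊔ h (j p.2) := by ac_rfl
      rw [e1, e2, ← sup_inf_left]
      refine sup_le (sup_le le_sup_left ?_) ?_
      · exact le_sup_of_le_right le_sup_right
      · exact le_sup_of_le_right le_sup_left
  rw [map_finset_sup]
  refine Finset.sup_le fun p hp => ?_
  have h1 : k (i p.1) ⊓ k (j p.2) ≤ k (t.sup fun p => i p.1 ⊓ j p.2) := by
    rw [← map_inf]
    exact (OrderHomClass.mono k (Finset.le_sup (f := fun p => i p.1 ⊓ j p.2) hp)).trans hxy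
  have := key p.1 p.2 t ⊥ ⊥ (by simpa using h1)
  simpa using this

/-- A finitary congruence is contained in the kernel of every homomorphism that satisfies its
basic inequalities. -/
theorem IsFinitary.le_ker {C : FrameCongruence M} (hC : C.IsFinitary i j) (h : FrameHom M N)
    (hs : ∀ a b a' b', QFrame.mk C (i a) ⊓ QFrame.mk C (j b) ≤
      QFrame.mk C (i a') ⊔ QFrame.mk C (j b') → h (i a) ⊓ h (j b) ≤ h (i a') ⊔ h (j b')) :
    C ≤ ker h := by
  obtain ⟨R, hR, rfl⟩ := hC
  exact generate_le_ker R h fun p hp =>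
    map_le_map_of_basic hs (hR hp).1 (hR hp).2 (mk_le_mk_of_mem hp)

/-- The basic inequality `i a ⊓ j b ≤ i a' ⊔ j b'` is between finitary elements. -/
theorem basic_mem_finitaryElements (a a' : A) (b b' : B) :
    (i a ⊓ j b, i a' ⊔ j b') ∈ finitaryElements i j ×ˢ finitaryElements i j := by
  classical
  exact ⟨⟨{(a, b)}, by simp⟩, ⟨{(a', ⊤), (⊤, b')}, by simp⟩⟩

end FrameCongruence

namespace Biframe

open FrameCongruence

/-- The extension of a biframe morphism to the main components. -/
noncomputable def Hom.main {L : Biframe.{u}} {M : Biframe.{v}} (f : Hom L M) :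
    FrameHom L.Main M.Main := f.exists_main.choose

theorem Hom.main_incPos {L : Biframe.{u}} {M : Biframe.{v}} (f : Hom L M) (a : L.Pos) :
    f.main (L.incPos a) = M.incPos (f.pos a) := f.exists_main.choose_spec.1 a

theorem Hom.main_incNeg {L : Biframe.{u}} {M : Biframe.{v}} (f : Hom L M) (b : L.Neg) :
    f.main (L.incNeg b) = M.incNeg (f.neg b) := f.exists_main.choose_spec.2 b

/-- The basic inequality `a ⊓ b ≤ a' ⊔ b'` holds at a point. -/
def Hom.Satisfies {L : Biframe.{u}} (f : Hom L two) (a : L.Pos) (b : L.Neg) (a' : L.Pos)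
    (b' : L.Neg) : Prop := f.pos a → f.neg b → f.pos a' ∨ f.neg b'

theorem Hom.satisfies_iff {L : Biframe.{u}} (f : Hom L two) (a : L.Pos) (b : L.Neg) (a' : L.Pos)
    (b' : L.Neg) : f.Satisfies a b a' b' ↔
      f.main (L.incPos a) ⊓ f.main (L.incNeg b) ≤ f.main (L.incPos a') ⊔ f.main (L.incNeg b') := by
  rw [f.main_incPos, f.main_incPos, f.main_incNeg, f.main_incNeg]
  exact ⟨fun h hx => h hx.1 hx.2, fun h hx hy => h ⟨hx, hy⟩⟩

theorem Hom.satisfies_of_le {L : Biframe.{u}} (f : Hom L two) {a a' : L.Pos} {b b' : L.Neg}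
    (h : L.incPos a ⊓ L.incNeg b ≤ L.incPos a' ⊔ L.incNeg b') : f.Satisfies a b a' b' := by
  rw [f.satisfies_iff, ← map_inf, ← map_sup]
  exact OrderHomClass.mono f.main h

theorem main_hom_ext {L : Biframe.{u}} {N : Type v} [Order.Frame N] {f g : FrameHom L.Main N}
    (hp : ∀ a, f (L.incPos a) = g (L.incPos a)) (hn : ∀ b, f (L.incNeg b) = g (L.incNeg b)) :
    f = g := by
  ext x
  obtain ⟨S, rfl⟩ := L.generated x
  simp only [map_iSup, map_inf, hp, hn]

/-- The main component is presented by basic inequalities: a pair of homomorphisms on the two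
generating frames extends to it as soon as it respects all the basic inequalities that hold
there. -/
def IsPresented (L : Biframe.{u}) : Prop :=
  ∀ (N : Type v) [Order.Frame N] (f : FrameHom L.Pos N) (g : FrameHom L.Neg N),
    (∀ a b a' b', L.incPos a ⊓ L.incNeg b ≤ L.incPos a' ⊔ L.incNeg b' →
      f a ⊓ g b ≤ f a' ⊔ g b') →
    ∃ h : FrameHom L.Main N, (∀ a, h (L.incPos a) = f a) ∧ ∀ b, h (L.incNeg b) = g b

theorem IsFinitary.isPresented {L : Biframe.{u}} (hL : L.IsFinitary) :
    IsPresented.{u, v} L := by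
  intro N _ f g hfg
  obtain ⟨C, hC, e, he, he'⟩ := hL
  have hle : C ≤ ker (FrameCoproduct.desc f g) := by
    refine hC.le_ker _ fun a b a' b' h => ?_
    simp only [FrameCoproduct.desc_inl, FrameCoproduct.desc_inr]
    apply hfg
    rw [← he, ← he, ← he', ← he', ← map_inf, ← map_sup]
    exact e.monotone h
  refine ⟨(QFrame.lift _ hle).comp (e.symm : FrameHom L.Main C.QFrame), fun a => ?_, fun b => ?_⟩
  · rw [FrameHom.comp_apply, ← he]
    change QFrame.lift _ hle (e.symm (e _)) = _
    rw [e.symm_apply_apply, QFrame.lift_mk, FrameCoproduct.desc_inl]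
  · rw [FrameHom.comp_apply, ← he']
    change QFrame.lift _ hle (e.symm (e _)) = _
    rw [e.symm_apply_apply, QFrame.lift_mk, FrameCoproduct.desc_inr]

theorem IsPresented.quotient {L : Biframe.{u}} (hL : IsPresented.{u, v} L)
    {C : FrameCongruence L.Main} (hC : C.IsFinitary L.incPos L.incNeg) :
    IsPresented.{u, v} (L.quotient C) := by
  intro N _ f g hfg
  have key : ∀ a b a' b', QFrame.mk C (L.incPos a) ⊓ QFrame.mk C (L.incNeg b) ≤
      QFrame.mk C (L.incPos a') ⊔ QFrame.mk C (L.incNeg b') →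
      f (QFrame.mk (C.comap L.incPos) a) ⊓ g (QFrame.mk (C.comap L.incNeg) b) ≤
      f (QFrame.mk (C.comap L.incPos) a') ⊔ g (QFrame.mk (C.comap L.incNeg) b') :=
    fun a b a' b' h => hfg _ _ _ _ h
  obtain ⟨h, hp, hn⟩ := hL N (f.comp (QFrame.mk (C.comap L.incPos)))
    (g.comp (QFrame.mk (C.comap L.incNeg))) fun a b a' b' hle => key a b a' b' (by
      rw [← map_inf, ← map_sup]
      exact OrderHomClass.mono (QFrame.mk C) hle)
  have hker : C ≤ ker h := hC.le_ker h fun a b a' b' hle => by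
    rw [hp, hp, hn, hn]
    exact key a b a' b' hle
  refine ⟨QFrame.lift h hker, fun p => ?_, fun p => ?_⟩
  · obtain ⟨a, rfl⟩ := QFrame.mk_surjective p
    exact hp a
  · obtain ⟨b, rfl⟩ := QFrame.mk_surjective p
    exact hn b

end Biframe

namespace Bispace

open FrameCongruence

theorem finOpens_isPresented (X : Bispace.{u}) : Biframe.IsPresented.{u, v} X.finOpens := by
  intro N _ (f : FrameHom X.OpensPos N) (g : FrameHom X.OpensNeg N) hfg
  have hle : generate X.finRel ≤ ker (FrameCoproduct.desc f g) := by
    refine generate_le_ker _ _ ?_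
    rintro _ ⟨U, U', V, V', h, rfl⟩
    rw [map_inf, map_sup, FrameCoproduct.desc_inl, FrameCoproduct.desc_inl,
      FrameCoproduct.desc_inr, FrameCoproduct.desc_inr]
    refine hfg _ _ _ _ ?_
    have := mk_le_mk_of_mem (R := X.finRel) ⟨U, U', V, V', h, rfl⟩
    rwa [map_inf, map_sup] at this
  exact ⟨QFrame.lift _ hle, fun a => FrameCoproduct.desc_inl _ _ _,
    fun b => FrameCoproduct.desc_inr _ _ _⟩

/-- The basic inequalities of `Ω_fin(X)` are exactly those that hold between sets of points. -/
theorem finOpens_le_iff (X : Bispace.{u}) (U U' : X.OpensPos) (V V' : X.OpensNeg) :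
    X.finOpens.incPos U ⊓ X.finOpens.incNeg V ≤ X.finOpens.incPos U' ⊔ X.finOpens.incNeg V' ↔
      (U : Set X) ∩ (V : Set X) ⊆ (U' : Set X) ∪ (V' : Set X) := by
  constructor
  · rintro h x hx
    exact Biframe.Hom.satisfies_of_le (L := X.finOpens) (X.psi x) h hx.1 hx.2
  · intro h
    have := mk_le_mk_of_mem (R := X.finRel) ⟨U, U', V, V', h, rfl⟩
    rwa [map_inf, map_sup] at this

end Bispace

/-! ### Validity of basic inequalities and bispatiality -/

namespace Biframe

open FrameCongruence

/-- The basic inequality `a ⊓ b ≤ a' ⊔ b'` holds at all points of a set. -/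
def ValidOn {L : Biframe.{u}} (Y : Set L.bpt) (a : L.Pos) (b : L.Neg) (a' : L.Pos)
    (b' : L.Neg) : Prop := ∀ f ∈ Y, Hom.Satisfies f a b a' b'

theorem phiPos_surjective (L : Biframe.{u}) : Function.Surjective L.phiPos := by
  rintro ⟨_, a, rfl⟩
  exact ⟨a, rfl⟩

theorem phiNeg_surjective (L : Biframe.{u}) : Function.Surjective L.phiNeg := by
  rintro ⟨_, a, rfl⟩
  exact ⟨a, rfl⟩

/-- Presented biframes are isomorphic as soon as their generating frames are, by isomorphisms that
preserve and reflect the basic inequalities. -/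
theorem IsPresented.exists_iso {L M : Biframe.{u}} (hL : IsPresented.{u, u} L)
    (hM : IsPresented.{u, u} M) (ePos : L.Pos ≃o M.Pos) (eNeg : L.Neg ≃o M.Neg)
    (h : ∀ a b a' b', L.incPos a ⊓ L.incNeg b ≤ L.incPos a' ⊔ L.incNeg b' ↔
      M.incPos (ePos a) ⊓ M.incNeg (eNeg b) ≤ M.incPos (ePos a') ⊔ M.incNeg (eNeg b')) :
    ∃ e : Iso L M, e.pos = ePos ∧ e.neg = eNeg := by
  obtain ⟨F, hFp, hFn⟩ := hL M.Main (M.incPos.comp (ePos : FrameHom L.Pos M.Pos))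
    (M.incNeg.comp (eNeg : FrameHom L.Neg M.Neg)) fun a b a' b' => (h a b a' b').1
  obtain ⟨G, hGp, hGn⟩ := hM L.Main (L.incPos.comp (ePos.symm : FrameHom M.Pos L.Pos))
    (L.incNeg.comp (eNeg.symm : FrameHom M.Neg L.Neg)) fun a b a' b' hle => (h _ _ _ _).2 (by
      change M.incPos (ePos (ePos.symm a)) ⊓ M.incNeg (eNeg (eNeg.symm b)) ≤
        M.incPos (ePos (ePos.symm a')) ⊔ M.incNeg (eNeg (eNeg.symm b'))
      simpa only [OrderIso.apply_symm_apply] using hle)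
  replace hFp (a) : F (L.incPos a) = M.incPos (ePos a) := hFp a
  replace hFn (a) : F (L.incNeg a) = M.incNeg (eNeg a) := hFn a
  replace hGp (a) : G (M.incPos a) = L.incPos (ePos.symm a) := hGp a
  replace hGn (a) : G (M.incNeg a) = L.incNeg (eNeg.symm a) := hGn a
  have hGF (x) : G (F x) = x := DFunLike.congr_fun (main_hom_ext (f := G.comp F)
    (g := FrameHom.id _) (fun a => by simp [hFp, hGp]) fun a => by simp [hFn, hGn]) x
  have hFG (x) : F (G x) = x := DFunLike.congr_fun (main_hom_ext (f := F.comp G)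
    (g := FrameHom.id _) (fun a => by simp [hFp, hGp]) fun a => by simp [hFn, hGn]) x
  refine ⟨⟨ePos, eNeg, ⟨⟨F, G, hGF, hFG⟩, fun {x y} => ⟨fun hxy => ?_,
    fun hxy => OrderHomClass.mono F hxy⟩⟩, hFp, hFn⟩, rfl, rfl⟩
  rw [← hGF x, ← hGF y]
  exact OrderHomClass.mono G hxy

/-- A biframe presented by basic inequalities is bispatial if and only if it has enough points to
refute every basic inequality that fails in it. -/
theorem isBispatial_iff {L : Biframe.{u}} (hL : IsPresented.{u, u} L) :
    L.IsBispatial ↔ ∀ a b a' b', ValidOn (Set.univ : Set L.bpt) a b a' b' →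
      L.incPos a ⊓ L.incNeg b ≤ L.incPos a' ⊔ L.incNeg b' := by
  constructor
  · rintro ⟨e, hp, hn⟩ a b a' b' h
    rw [← e.main.le_iff_le, map_inf, map_sup, e.main_incPos, e.main_incPos, e.main_incNeg,
      e.main_incNeg, hp, hp, hn, hn, Bispace.finOpens_le_iff]
    exact fun f hf => h f trivial hf.1 hf.2
  · intro h
    let ePos : L.Pos ≃o L.bpt.OpensPos := RelIso.ofSurjective (OrderEmbedding.ofMapLEIff L.phiPos
      fun a b => ⟨fun hab => by
        have h1 := h a ⊤ b ⊥ fun f _ hf _ => Or.inl (hab hf)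
        rw [map_top, map_bot, inf_top_eq, sup_bot_eq, ← inf_eq_left, ← map_inf] at h1
        exact inf_eq_left.1 (L.incPos_injective h1),
        fun hab f hf => (OrderHomClass.mono (Hom.pos f) hab : f.pos a ≤ f.pos b) hf⟩)
      L.phiPos_surjective
    let eNeg : L.Neg ≃o L.bpt.OpensNeg := RelIso.ofSurjective (OrderEmbedding.ofMapLEIff L.phiNeg
      fun a b => ⟨fun hab => by
        have h1 := h ⊤ a ⊥ b fun f _ _ hf => Or.inr (hab hf)
        rw [map_top, map_bot, top_inf_eq, bot_sup_eq, ← inf_eq_left, ← map_inf] at h1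
        exact inf_eq_left.1 (L.incNeg_injective h1),
        fun hab f hf => (OrderHomClass.mono (Hom.neg f) hab : f.neg a ≤ f.neg b) hf⟩)
      L.phiNeg_surjective
    obtain ⟨e, hp, hn⟩ := hL.exists_iso L.bpt.finOpens_isPresented ePos eNeg fun a b a' b' =>
      ⟨fun hle => (L.bpt.finOpens_le_iff _ _ _ _).2
          fun f hf => Hom.satisfies_of_le f hle hf.1 hf.2,
        fun hle => h a b a' b' fun f _ hf hf' => (L.bpt.finOpens_le_iff _ _ _ _).1 hle ⟨hf, hf'⟩⟩
    exact ⟨e, fun a => DFunLike.congr_fun hp a, fun b => DFunLike.congr_fun hn b⟩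

/-! ### The points of a biquotient -/

/-- The basic inequality `a ⊓ b ≤ a' ⊔ b'` holds in the biquotient `L/C`. -/
def Biquotient.Entails {L : Biframe.{u}} (Q : L.Biquotient) (a : L.Pos) (b : L.Neg) (a' : L.Pos)
    (b' : L.Neg) : Prop :=
  QFrame.mk Q.cong (L.incPos a) ⊓ QFrame.mk Q.cong (L.incNeg b) ≤
    QFrame.mk Q.cong (L.incPos a') ⊔ QFrame.mk Q.cong (L.incNeg b')

theorem Biquotient.le_iff {L : Biframe.{u}} {Q Q' : L.Biquotient} :
    Q ≤ Q' ↔ ∀ a b a' b', Q'.Entails a b a' b' → Q.Entails a b a' b' := by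
  constructor
  · intro h a b a' b' hQ
    unfold Entails at *
    rw [← map_inf, ← map_sup, QFrame.mk_le_mk] at hQ ⊢
    exact h _ _ hQ
  · intro h
    have := Q'.isFinitary.le_ker (QFrame.mk Q.cong) h
    rwa [ker_mk] at this

theorem Biquotient.mem_points_iff {L : Biframe.{u}} (Q : L.Biquotient) (f : L.bpt) :
    f ∈ Q.points ↔ ∀ a b a' b', Q.Entails a b a' b' → Hom.Satisfies f a b a' b' := by
  constructor
  · rintro ⟨g, rfl⟩ a b a' b' h
    exact Hom.satisfies_of_le (L := L.quotient Q.cong) g (a := QFrame.mk _ a)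
      (b := QFrame.mk _ b) (a' := QFrame.mk _ a') (b' := QFrame.mk _ b') h
  · intro h
    change Hom L two at f
    have hle : Q.cong ≤ ker f.main := Q.isFinitary.le_ker f.main fun a b a' b' hE =>
      (f.satisfies_iff _ _ _ _).1 (h a b a' b' hE)
    have hp : Q.cong.comap L.incPos ≤ ker f.pos := fun x y hxy => by
      have : f.main (L.incPos x) = f.main (L.incPos y) := hle _ _ hxy
      rwa [f.main_incPos, f.main_incPos] at this
    have hn : Q.cong.comap L.incNeg ≤ ker f.neg := fun x y hxy => by
      have : f.main (L.incNeg x) = f.main (L.incNeg y) := hle _ _ hxy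
      rwa [f.main_incNeg, f.main_incNeg] at this
    refine ⟨(⟨QFrame.lift f.pos hp, QFrame.lift f.neg hn, QFrame.lift f.main hle, fun p => ?_,
      fun p => ?_⟩ : Hom (L.quotient Q.cong) two), ?_⟩
    · obtain ⟨a, rfl⟩ := QFrame.mk_surjective p
      exact f.main_incPos a
    · obtain ⟨b, rfl⟩ := QFrame.mk_surjective p
      exact f.main_incNeg b
    · rfl

theorem Biquotient.isBispatial_iff {L : Biframe.{u}} (hL : L.IsFinitary) (Q : L.Biquotient) :
    Q.toBiframe.IsBispatial ↔ ∀ a b a' b', ValidOn Q.points a b a' b' → Q.Entails a b a' b' := by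
  have hQ : IsPresented.{u, u} Q.toBiframe := hL.isPresented.quotient Q.isFinitary
  rw [Biframe.isBispatial_iff hQ]
  constructor
  · intro h a b a' b' hab
    exact h (QFrame.mk _ a) (QFrame.mk _ b) (QFrame.mk _ a') (QFrame.mk _ b') fun g _ =>
      hab _ ⟨g, rfl⟩
  · intro h p q p' q' hpq
    obtain ⟨a, rfl⟩ := QFrame.mk_surjective p
    obtain ⟨b, rfl⟩ := QFrame.mk_surjective q
    obtain ⟨a', rfl⟩ := QFrame.mk_surjective p'
    obtain ⟨b', rfl⟩ := QFrame.mk_surjective q'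
    refine h a b a' b' ?_
    rintro _ ⟨g, rfl⟩
    exact hpq g trivial

/-- The biquotient by all basic inequalities valid on a set of points. -/
def biquotientOf {L : Biframe.{u}} (Y : Set L.bpt) : L.Biquotient where
  cong := generate {p | ∃ a b a' b', ValidOn Y a b a' b' ∧
    p = (L.incPos a ⊓ L.incNeg b, L.incPos a' ⊔ L.incNeg b')}
  isFinitary := by
    refine ⟨_, ?_, rfl⟩
    rintro _ ⟨a, b, a', b', _, rfl⟩
    exact basic_mem_finitaryElements a a' b b'

theorem biquotientOf_entails_iff {L : Biframe.{u}} {Y : Set L.bpt} {a : L.Pos} {b : L.Neg}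
    {a' : L.Pos} {b' : L.Neg} :
    (biquotientOf Y).Entails a b a' b' ↔ ValidOn Y a b a' b' := by
  constructor
  · intro h f hf
    change Hom L two at f
    have hle : (biquotientOf Y).cong ≤ ker f.main := generate_le_ker _ _ (by
      rintro _ ⟨a, b, a', b', h, rfl⟩
      rw [map_inf, map_sup]
      exact (f.satisfies_iff _ _ _ _).1 (h f hf))
    have := OrderHomClass.mono (QFrame.lift f.main hle) h
    rw [map_inf, map_sup] at this
    exact (f.satisfies_iff _ _ _ _).2 this
  · intro h
    unfold Biquotient.Entails
    rw [← map_inf, ← map_sup]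
    exact mk_le_mk_of_mem (p := (_, _)) ⟨a, b, a', b', h, rfl⟩

/-- The set of all points at which every basic inequality valid on `Y` holds. -/
def hull {L : Biframe.{u}} (Y : Set L.bpt) : Set L.bpt :=
  {f | ∀ a b a' b', ValidOn Y a b a' b' → Hom.Satisfies f a b a' b'}

theorem subset_hull {L : Biframe.{u}} (Y : Set L.bpt) : Y ⊆ hull Y := fun _ hf _ _ _ _ h => h _ hf

theorem points_biquotientOf {L : Biframe.{u}} (Y : Set L.bpt) :
    (biquotientOf Y).points = hull Y := by
  ext f
  rw [Biquotient.mem_points_iff]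
  simp only [biquotientOf_entails_iff]
  rfl

theorem Biquotient.hull_points {L : Biframe.{u}} (Q : L.Biquotient) :
    hull Q.points = Q.points := by
  refine Set.Subset.antisymm (fun f hf => ?_) (subset_hull _)
  rw [Q.mem_points_iff]
  exact fun a b a' b' h => hf a b a' b' fun g hg => (Q.mem_points_iff g).1 hg a b a' b' h

theorem biquotientOf_isBispatial {L : Biframe.{u}} (hL : L.IsFinitary) (Y : Set L.bpt) :
    (biquotientOf Y).toBiframe.IsBispatial := by
  rw [Biquotient.isBispatial_iff hL, points_biquotientOf]
  exact fun a b a' b' h => biquotientOf_entails_iff.2 fun f hf => h f (subset_hull Y hf)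

/-- Bispatial biquotients correspond to the sets of points axiomatised by basic inequalities. -/
noncomputable def bispatialEquiv {L : Biframe.{u}} (hL : L.IsFinitary) :
    L.BispatialBiquotient ≃o {Y : Set L.bpt // hull Y = Y} :=
  RelIso.ofSurjective (OrderEmbedding.ofMapLEIff (fun Q => ⟨Q.1.points, Q.1.hull_points⟩)
    fun Q Q' => by
      change Q.1.points ⊆ Q'.1.points ↔ Q.1 ≤ Q'.1
      rw [Biquotient.le_iff]
      constructor
      · exact fun h a b a' b' hE => (Biquotient.isBispatial_iff hL Q.1).1 Q.2 _ _ _ _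
          fun f hf => (Q'.1.mem_points_iff f).1 (h hf) _ _ _ _ hE
      · intro h f hf
        rw [Biquotient.mem_points_iff] at hf ⊢
        exact fun a b a' b' hE => hf _ _ _ _ (h _ _ _ _ hE))
    fun Y => ⟨⟨biquotientOf Y.1, biquotientOf_isBispatial hL _⟩,
      Subtype.ext ((points_biquotientOf Y.1).trans Y.2)⟩

end Biframe

/-! ### Bisober bisubspaces -/

/-- A homomorphism factors through a surjective one if it respects the order of the images. -/
theorem FrameHom.exists_factor {A : Type u} {B : Type v} {N : Type w} [Order.Frame A]
    [Order.Frame B] [Order.Frame N] {r : FrameHom A B} (hr : Function.Surjective r)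
    (f : FrameHom A N) (h : ∀ a b, r a ≤ r b → f a ≤ f b) :
    ∃ g : FrameHom B N, ∀ a, g (r a) = f a := by
  let s := Function.surjInv hr
  have hs (x : B) : r (s x) = x := Function.surjInv_eq hr x
  have e (a : A) : f (s (r a)) = f a := le_antisymm (h _ _ (hs _).le) (h _ _ (hs _).ge)
  refine ⟨{ toFun := fun x => f (s x), map_inf' := fun x y => ?_, map_top' := ?_,
            map_sSup' := fun S => ?_ }, e⟩
  · rw [← map_inf, ← e (s x ⊓ s y), map_inf, hs, hs]
  · rw [← map_top r, e, map_top]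
  · have hS : sSup S = r (sSup (s '' S)) := by
      rw [map_sSup, Set.image_image]
      simp only [hs, Set.image_id']
    rw [hS, e, map_sSup, Set.image_image]

namespace Bispace

/-- The unit `ψ` is always initial and open onto its image, so that only its bijectivity is in
question. -/
theorem isBisober_iff_bijective (X : Bispace.{u}) :
    X.IsBisober ↔ Function.Bijective X.psi := by
  constructor
  · rintro ⟨h, hh⟩
    have : X.psi = h.toEquiv := funext fun x => (hh x).symm
    rw [this]
    exact h.toEquiv.bijective
  · intro h
    let e := Equiv.ofBijective X.psi h
    have he (p : X.finOpens.bpt) : X.psi (e.symm p) = p := e.apply_symm_apply p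
    refine ⟨⟨e, ?_, ?_, ?_, ?_⟩, fun _ => rfl⟩
    · refine continuous_def.2 ?_
      rintro _ ⟨U, rfl⟩
      exact @TopologicalSpace.Opens.isOpen X X.pos U
    · refine continuous_def.2 ?_
      rintro _ ⟨U, rfl⟩
      exact @TopologicalSpace.Opens.isOpen X X.neg U
    · refine continuous_def.2 fun U hU => ?_
      refine ⟨@TopologicalSpace.Opens.mk X X.pos U hU, Set.ext fun p => ?_⟩
      conv_rhs => rw [← he p]
      rfl
    · refine continuous_def.2 fun U hU => ?_
      refine ⟨@TopologicalSpace.Opens.mk X X.neg U hU, Set.ext fun p => ?_⟩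
      conv_rhs => rw [← he p]
      rfl

end Bispace

namespace Biframe

open FrameCongruence

/-- Restriction of the positive opens `φ⁺(a)` to a bisubspace of the bispectrum. -/
def restrictPos {L : Biframe.{u}} (Y : Set L.bpt) :
    FrameHom L.Pos (L.bpt.subspace Y).OpensPos where
  toFun a := @TopologicalSpace.Opens.mk _ (L.bpt.subspace Y).pos
    {y : Y | (y.1 : Hom L two).pos a} ⟨_, ⟨a, rfl⟩, rfl⟩
  map_inf' a b := SetLike.coe_injective (Set.ext fun y =>
    iff_of_eq (map_inf (Hom.pos (y.1 : Hom L two)) a b))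
  map_top' := SetLike.coe_injective (Set.ext fun y =>
    iff_of_eq (map_top (Hom.pos (y.1 : Hom L two))))
  map_sSup' S := SetLike.coe_injective (Set.ext fun y => by
    let _ := (L.bpt.subspace Y).pos
    simp [sSup_image]
    rfl)

/-- Restriction of the negative opens `φ⁻(b)` to a bisubspace of the bispectrum. -/
def restrictNeg {L : Biframe.{u}} (Y : Set L.bpt) :
    FrameHom L.Neg (L.bpt.subspace Y).OpensNeg where
  toFun a := @TopologicalSpace.Opens.mk _ (L.bpt.subspace Y).neg
    {y : Y | (y.1 : Hom L two).neg a} ⟨_, ⟨a, rfl⟩, rfl⟩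
  map_inf' a b := SetLike.coe_injective (Set.ext fun y =>
    iff_of_eq (map_inf (Hom.neg (y.1 : Hom L two)) a b))
  map_top' := SetLike.coe_injective (Set.ext fun y =>
    iff_of_eq (map_top (Hom.neg (y.1 : Hom L two))))
  map_sSup' S := SetLike.coe_injective (Set.ext fun y => by
    let _ := (L.bpt.subspace Y).neg
    simp [sSup_image]
    rfl)

theorem restrictPos_surjective {L : Biframe.{u}} (Y : Set L.bpt) :
    Function.Surjective (restrictPos Y) := by
  rintro ⟨_, _, ⟨a, rfl⟩, rfl⟩
  exact ⟨a, rfl⟩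

theorem restrictNeg_surjective {L : Biframe.{u}} (Y : Set L.bpt) :
    Function.Surjective (restrictNeg Y) := by
  rintro ⟨_, _, ⟨a, rfl⟩, rfl⟩
  exact ⟨a, rfl⟩

theorem restrict_le_iff {L : Biframe.{u}} (Y : Set L.bpt) (a : L.Pos) (b : L.Neg) (a' : L.Pos)
    (b' : L.Neg) : (L.bpt.subspace Y).finOpens.incPos (restrictPos Y a) ⊓
      (L.bpt.subspace Y).finOpens.incNeg (restrictNeg Y b) ≤
      (L.bpt.subspace Y).finOpens.incPos (restrictPos Y a') ⊔
      (L.bpt.subspace Y).finOpens.incNeg (restrictNeg Y b') ↔ ValidOn Y a b a' b' := by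
  rw [Bispace.finOpens_le_iff]
  exact ⟨fun h f hf ha hb => @h ⟨f, hf⟩ ⟨ha, hb⟩, fun h f hf => h f.1 f.2 hf.1 hf.2⟩

/-- Every point in the hull of `Y` induces a point of `Ω_fin(Y)`. -/
theorem exists_point_of_mem_hull {L : Biframe.{u}} {Y : Set L.bpt} {f : Hom L two}
    (hf : f ∈ (hull Y : Set (Hom L two))) :
    ∃ p : Hom (L.bpt.subspace Y).finOpens two, (∀ a, p.pos (restrictPos Y a) = f.pos a) ∧
      ∀ b, p.neg (restrictNeg Y b) = f.neg b := by
  obtain ⟨p, hp⟩ := FrameHom.exists_factor (restrictPos_surjective Y) f.pos fun a a' h ha => by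
    have := hf a ⊤ a' ⊥ (fun g hg hga _ => Or.inl (@h ⟨g, hg⟩ hga)) ha (by simp)
    simpa using this
  obtain ⟨n, hn⟩ := FrameHom.exists_factor (restrictNeg_surjective Y) f.neg fun b b' h hb => by
    have := hf ⊤ b ⊥ b' (fun g hg _ hgb => Or.inr (@h ⟨g, hg⟩ hgb)) (by simp) hb
    simpa using this
  refine ⟨⟨p, n, (L.bpt.subspace Y).finOpens_isPresented Prop p n fun U V U' V' h => ?_⟩, hp, hn⟩
  obtain ⟨a, rfl⟩ := restrictPos_surjective Y U
  obtain ⟨b, rfl⟩ := restrictNeg_surjective Y V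
  obtain ⟨a', rfl⟩ := restrictPos_surjective Y U'
  obtain ⟨b', rfl⟩ := restrictNeg_surjective Y V'
  have H := hf a b a' b' ((restrict_le_iff Y a b a' b').1 h)
  unfold Hom.Satisfies at H
  rw [← hp a, ← hp a', ← hn b, ← hn b'] at H
  exact fun hab => H hab.1 hab.2

/-- Every point of `Ω_fin(Y)` comes from a point in the hull of `Y`. -/
theorem exists_mem_hull_of_point {L : Biframe.{u}} (hL : L.IsFinitary) {Y : Set L.bpt}
    (p : Hom (L.bpt.subspace Y).finOpens two) :
    ∃ f : Hom L two, f ∈ (hull Y : Set (Hom L two)) ∧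
      (∀ a, p.pos (restrictPos Y a) = f.pos a) ∧ ∀ b, p.neg (restrictNeg Y b) = f.neg b := by
  let P : FrameHom L.Pos Prop := FrameHom.comp (β := (L.bpt.subspace Y).OpensPos) p.pos
    (restrictPos Y)
  let N : FrameHom L.Neg Prop := FrameHom.comp (β := (L.bpt.subspace Y).OpensNeg) p.neg
    (restrictNeg Y)
  have key (a b a' b') (h : ValidOn Y a b a' b') : P a → N b → P a' ∨ N b' :=
    p.satisfies_of_le ((restrict_le_iff Y a b a' b').2 h)
  exact ⟨⟨P, N, hL.isPresented Prop P N fun a b a' b' h hab =>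
    key a b a' b' (fun f _ => Hom.satisfies_of_le f h) hab.1 hab.2⟩, key, fun _ => rfl,
    fun _ => rfl⟩

theorem subspace_isBisober_iff {L : Biframe.{u}} (hL : L.IsFinitary) (Y : Set L.bpt) :
    (L.bpt.subspace Y).IsBisober ↔ hull Y = Y := by
  rw [Bispace.isBisober_iff_bijective]
  constructor
  · intro h
    refine Set.Subset.antisymm (fun f hf => ?_) (subset_hull Y)
    obtain ⟨p, hp, hn⟩ := exists_point_of_mem_hull hf
    obtain ⟨y, rfl⟩ := h.2 p
    have : y.1 = f := Hom.ext (FrameHom.ext hp) (FrameHom.ext hn)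
    exact this ▸ y.2
  · intro h
    constructor
    · intro y z hyz
      refine Subtype.ext (Hom.ext (FrameHom.ext fun a => ?_) (FrameHom.ext fun b => ?_))
      · exact congrArg (fun p : Hom (L.bpt.subspace Y).finOpens two => p.pos (restrictPos Y a)) hyz
      · exact congrArg (fun p : Hom (L.bpt.subspace Y).finOpens two => p.neg (restrictNeg Y b)) hyz
    · intro p
      obtain ⟨f, hf, hp, hn⟩ := exists_mem_hull_of_point hL p
      refine ⟨⟨f, h ▸ hf⟩, Hom.ext (FrameHom.ext fun U => ?_) (FrameHom.ext fun V => ?_)⟩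
      · obtain ⟨a, rfl⟩ := restrictPos_surjective Y U
        exact (hp a).symm
      · obtain ⟨b, rfl⟩ := restrictNeg_surjective Y V
        exact (hn b).symm

end Biframe

/-! ### The patch of the Skula bispace -/

namespace Bispace

open Topology

/-- The patch topology of the Skula bispace, as a topology on the points of the original one. -/
abbrev skulaPatch (X : Bispace.{u}) : TopologicalSpace X := X.skula.patch

/-- The sets `U⁺ ∩ U⁻ ∩ (V⁺)ᶜ ∩ (V⁻)ᶜ` form a basis of the patch topology of the Skula
bispace. -/
theorem isOpen_skula_patch_iff {X : Bispace.{u}} {S : Set X} :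
    IsOpen[X.skulaPatch] S ↔ ∀ x ∈ S, ∃ U V U' V' : Set X, IsOpen[X.pos] U ∧ IsOpen[X.neg] V ∧
      IsOpen[X.pos] U' ∧ IsOpen[X.neg] V' ∧ x ∈ U ∩ V ∩ U'ᶜ ∩ V'ᶜ ∧
      U ∩ V ∩ U'ᶜ ∩ V'ᶜ ⊆ S := by
  constructor
  · let τ : TopologicalSpace X :=
      { IsOpen := fun S => ∀ x ∈ S, ∃ U V U' V' : Set X, IsOpen[X.pos] U ∧ IsOpen[X.neg] V ∧
          IsOpen[X.pos] U' ∧ IsOpen[X.neg] V' ∧ x ∈ U ∩ V ∩ U'ᶜ ∩ V'ᶜ ∧ U ∩ V ∩ U'ᶜ ∩ V'ᶜ ⊆ S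
        isOpen_univ := fun x _ => ⟨Set.univ, Set.univ, ∅, ∅, X.pos.isOpen_univ,
          X.neg.isOpen_univ, @isOpen_empty _ X.pos, @isOpen_empty _ X.neg, by simp, by simp⟩
        isOpen_inter := by
          intro S T hS hT x hx
          obtain ⟨U, V, U', V', hU, hV, hU', hV', hxS, hsub⟩ := hS x hx.1
          obtain ⟨W, Z, W', Z', hW, hZ, hW', hZ', hxT, hsub'⟩ := hT x hx.2
          refine ⟨U ∩ W, V ∩ Z, U' ∪ W', V' ∪ Z', X.pos.isOpen_inter _ _ hU hW,
            X.neg.isOpen_inter _ _ hV hZ, @IsOpen.union _ _ _ X.pos hU' hW',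
            @IsOpen.union _ _ _ X.neg hV' hZ', ?_, fun y hy => ⟨hsub ?_, hsub' ?_⟩⟩
          · simp only [Set.mem_inter_iff, Set.mem_compl_iff, Set.mem_union] at *
            tauto
          · simp only [Set.mem_inter_iff, Set.mem_compl_iff, Set.mem_union] at *
            tauto
          · simp only [Set.mem_inter_iff, Set.mem_compl_iff, Set.mem_union] at *
            tauto
        isOpen_sUnion := by
          rintro 𝒮 h x ⟨S, hS, hx⟩
          obtain ⟨U, V, U', V', hU, hV, hU', hV', hxS, hsub⟩ := h S hS x hx
          exact ⟨U, V, U', V', hU, hV, hU', hV', hxS, hsub.trans (Set.subset_sUnion_of_mem hS)⟩ }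
    have h1 (U : Set X) (hU : IsOpen[X.pos] U) : IsOpen[τ] U := fun x hx =>
      ⟨U, Set.univ, ∅, ∅, hU, X.neg.isOpen_univ, @isOpen_empty _ X.pos, @isOpen_empty _ X.neg,
        by simpa using hx, by simp⟩
    have h2 (U : Set X) (hU : IsOpen[X.neg] U) : IsOpen[τ] U := fun x hx =>
      ⟨Set.univ, U, ∅, ∅, X.pos.isOpen_univ, hU, @isOpen_empty _ X.pos, @isOpen_empty _ X.neg,
        by simpa using hx, by simp⟩
    have h3 (F : Set X) (hF : IsClosed[X.pos] F) : IsOpen[τ] F := fun x hx =>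
      ⟨Set.univ, Set.univ, Fᶜ, ∅, X.pos.isOpen_univ, X.neg.isOpen_univ,
        (@isOpen_compl_iff _ _ X.pos).2 hF, @isOpen_empty _ X.neg, by simpa using hx, by simp⟩
    have h4 (F : Set X) (hF : IsClosed[X.neg] F) : IsOpen[τ] F := fun x hx =>
      ⟨Set.univ, Set.univ, ∅, Fᶜ, X.pos.isOpen_univ, X.neg.isOpen_univ,
        @isOpen_empty _ X.pos, (@isOpen_compl_iff _ _ X.neg).2 hF, by simpa using hx, by simp⟩
    have hpos : τ ≤ X.skula.pos := le_generateFrom (by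
      rintro U (hU | hU)
      · exact h1 U hU
      · exact h4 U hU)
    have hneg : τ ≤ X.skula.neg := le_generateFrom (by
      rintro U (hU | hU)
      · exact h2 U hU
      · exact h3 U hU)
    have hτ : τ ≤ X.skula.patch := le_generateFrom (by
      rintro U (hU | hU)
      · exact hpos U hU
      · exact hneg U hU)
    exact hτ S
  · intro h
    let _ := X.skulaPatch
    refine isOpen_iff_forall_mem_open.2 fun x hx => ?_
    obtain ⟨U, V, U', V', hU, hV, hU', hV', hxS, hsub⟩ := h x hx
    refine ⟨_, hsub, ?_, hxS⟩
    have o1 : IsOpen[X.skulaPatch] U := .basic _ (Or.inl (.basic _ (Or.inl hU)))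
    have o2 : IsOpen[X.skulaPatch] V := .basic _ (Or.inr (.basic _ (Or.inl hV)))
    have o3 : IsOpen[X.skulaPatch] U'ᶜ := .basic _ (Or.inr (.basic _ (Or.inr
      ((@isClosed_compl_iff _ X.pos _).2 hU'))))
    have o4 : IsOpen[X.skulaPatch] V'ᶜ := .basic _ (Or.inl (.basic _ (Or.inr
      ((@isClosed_compl_iff _ X.neg _).2 hV'))))
    exact ((o1.inter o2).inter o3).inter o4

theorem isBiTD_iff_skula_isPatchDiscrete (X : Bispace.{u}) :
    X.IsBiTD ↔ X.skula.IsPatchDiscrete := by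
  constructor
  · intro h S
    refine isOpen_skula_patch_iff.2 fun x hx => ?_
    obtain ⟨U, V, U', V', hU, hV, hU', hV', hxe⟩ := h x
    exact ⟨U, V, U', V', hU, hV, hU', hV', hxe ▸ rfl, hxe ▸ Set.singleton_subset_iff.2 hx⟩
  · intro h x
    obtain ⟨U, V, U', V', hU, hV, hU', hV', hxS, hsub⟩ := isOpen_skula_patch_iff.1 (h {x}) x rfl
    exact ⟨U, V, U', V', hU, hV, hU', hV', (Set.singleton_subset_iff.2 hxS).antisymm hsub⟩

/-- A bihomeomorphism is a homeomorphism of the patch topologies. -/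
theorem Bihomeo.isPatchDiscrete_iff {X : Bispace.{u}} {Y : Bispace.{v}} (e : Bihomeo X Y) :
    X.IsPatchDiscrete ↔ Y.IsPatchDiscrete := by
  have h1 : Continuous[X.patch, Y.patch] e.toFun := continuous_generateFrom_iff.2 (by
    rintro U (hU | hU)
    · exact .basic _ (Or.inl (continuous_def.1 e.continuous_pos U hU))
    · exact .basic _ (Or.inr (continuous_def.1 e.continuous_neg U hU)))
  have h2 : Continuous[Y.patch, X.patch] e.invFun := continuous_generateFrom_iff.2 (by
    rintro U (hU | hU)
    · exact .basic _ (Or.inl (continuous_def.1 e.continuous_inv_pos U hU))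
    · exact .basic _ (Or.inr (continuous_def.1 e.continuous_inv_neg U hU)))
  constructor
  · intro h U
    have := continuous_def.1 h2 _ (h (e.toEquiv ⁻¹' U))
    exact e.toEquiv.symm_preimage_preimage U ▸ this
  · intro h U
    have := continuous_def.1 h1 _ (h (e.toEquiv.symm ⁻¹' U))
    exact e.toEquiv.preimage_symm_preimage U ▸ this

end Bispace

namespace Biframe

open Topology

/-- The hull is the closure in the patch of the Skula bispace, since a failing basic inequality
`a ⊓ b ≤ a' ⊔ b'` amounts to a basic open neighbourhood disjoint from the set. -/
theorem hull_eq_self_iff {L : Biframe.{u}} (Y : Set L.bpt) :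
    hull Y = Y ↔ IsClosed[L.bpt.skulaPatch] Y := by
  rw [← @isOpen_compl_iff _ Y L.bpt.skulaPatch, Bispace.isOpen_skula_patch_iff]
  constructor
  · intro h f hf
    rw [← h] at hf
    simp only [hull, Set.mem_compl_iff, Set.mem_ofPred_eq, not_forall] at hf
    obtain ⟨a, b, a', b', hY, hf⟩ := hf
    refine ⟨_, _, _, _, ⟨a, rfl⟩, ⟨b, rfl⟩, ⟨a', rfl⟩, ⟨b', rfl⟩, ?_, ?_⟩
    · unfold Hom.Satisfies at hf
      push Not at hf
      exact ⟨⟨⟨hf.1, hf.2.1⟩, hf.2.2.1⟩, hf.2.2.2⟩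
    · rintro g ⟨⟨⟨ha, hb⟩, ha'⟩, hb'⟩ hg
      exact (hY g hg ha hb).elim ha' hb'
  · intro h
    refine Set.Subset.antisymm (fun f hf => ?_) (subset_hull Y)
    by_contra hfY
    obtain ⟨_, _, _, _, ⟨a, rfl⟩, ⟨b, rfl⟩, ⟨a', rfl⟩, ⟨b', rfl⟩, hfm, hsub⟩ := h f hfY
    refine (hf a b a' b' (fun g hg ha hb => ?_) hfm.1.1.1 hfm.1.1.2).elim hfm.1.2 hfm.2
    by_contra hg'
    rw [not_or] at hg'
    exact hsub ⟨⟨⟨ha, hb⟩, hg'.1⟩, hg'.2⟩ hg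

/-- Points are separated by basic inequalities, since each of the sets `{f | f⁺(a) = 1}` and
`{f | f⁻(b) = 1}` is axiomatised by one, and so is its complement. -/
theorem hull_singleton {L : Biframe.{u}} (f : L.bpt) : hull {f} = {f} := by
  refine Set.Subset.antisymm (fun g hg => ?_) (subset_hull _)
  change Hom L two at f g
  have hvalid {a b a' b'} (h : f.Satisfies a b a' b') : g.Satisfies a b a' b' := hg a b a' b' (by
    rintro _ rfl
    exact h)
  refine Hom.ext (FrameHom.ext fun a => propext ⟨fun h => ?_, fun h => ?_⟩)
    (FrameHom.ext fun b => propext ⟨fun h => ?_, fun h => ?_⟩)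
  · by_contra hf
    have := hvalid (a := a) (b := ⊤) (a' := ⊥) (b' := ⊥) (fun h _ => (hf h).elim) h (by simp)
    simp at this
  · have := hvalid (a := ⊤) (b := ⊤) (a' := a) (b' := ⊥) (fun _ _ => Or.inl h) (by simp) (by simp)
    simpa using this
  · by_contra hf
    have := hvalid (a := ⊤) (b := b) (a' := ⊥) (b' := ⊥) (fun _ h => (hf h).elim) (by simp) h
    simp at this
  · have := hvalid (a := ⊤) (b := ⊤) (a' := ⊥) (b' := b) (fun _ _ => Or.inr h) (by simp) (by simp)
    simpa using this

end Biframe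

/-! ### Points of the assembly -/

namespace FrameCongruence

variable {A : Type u} [Order.Frame A]

theorem isCompl_nabla_delta (a : A) : IsCompl (nabla a) (delta a) := by
  constructor
  · rw [disjoint_iff_inf_le]
    rintro x y ⟨h, h'⟩
    rw [eq_of_inf_eq_sup_eq h' h]
  · rw [codisjoint_iff_le_sup]
    intro x y _
    have h := nabla_le_iff.1 (le_sup_left : nabla a ≤ nabla a ⊔ delta a)
    have h' := delta_le_iff.1 (le_sup_right : delta a ≤ nabla a ⊔ delta a)
    set D := nabla a ⊔ delta a
    have e (z : A) : D.r z ⊥ := by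
      simpa using D.inf' (D.refl' z) (D.trans' (D.symm' h') h)
    exact D.trans' (e x) (D.symm' (e y))

/-- The kernel of a point `f` of a frame is a prime element of the assembly, and so gives a
point of the assembly: it maps a congruence to `0` if and only if it lies below the kernel. -/
def assemblyPoint (f : FrameHom A Prop) : FrameHom (FrameCongruence A) Prop where
  toFun C := ¬ C ≤ ker f
  map_inf' C D := by
    apply propext
    constructor
    · exact fun h => ⟨fun hC => h (inf_le_left.trans hC), fun hD => h (inf_le_right.trans hD)⟩
    · rintro ⟨hC, hD⟩ h
      have key (E : FrameCongruence A) (hE : ¬ E ≤ ker f) :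
          ∃ x y, E.r x y ∧ x ≤ y ∧ ¬ f x ∧ f y := by
        by_contra! H
        refine hE fun x y hxy => ?_
        have hx : E.r (x ⊓ y) x := by simpa using E.inf' (E.refl' x) (E.symm' hxy)
        have hy : E.r (x ⊓ y) y := by simpa using E.inf' hxy (E.refl' y)
        have h1 := H _ _ hx inf_le_left
        have h2 := H _ _ hy inf_le_right
        have h3 : f (x ⊓ y) = (f x ∧ f y) := map_inf f x y
        rw [h3] at h1 h2
        change f x = f y
        exact propext (by tauto)
      obtain ⟨x, y, hxy, hle, hx, hy⟩ := key C hC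
      obtain ⟨u, v, huv, hle', hu, hv⟩ := key D hD
      -- The pair `(x ⊓ v) ⊔ (y ⊓ u)`, `y ⊓ v` lies in both congruences and is separated by `f`.
      have h1 : C.r ((x ⊓ v) ⊔ (y ⊓ u)) (y ⊓ v) := by
        have := C.sup_rel (C.inf' hxy (C.refl' v)) (C.refl' (y ⊓ u))
        rwa [sup_eq_left.2 (inf_le_inf_left y hle')] at this
      have h2 : D.r ((x ⊓ v) ⊔ (y ⊓ u)) (y ⊓ v) := by
        have := D.sup_rel (D.refl' (x ⊓ v)) (D.inf' (D.refl' y) huv)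
        rwa [sup_eq_right.2 (inf_le_inf_right v hle)] at this
      have h3 : f ((x ⊓ v) ⊔ (y ⊓ u)) = f (y ⊓ v) := h _ _ ⟨h1, h2⟩
      rw [map_sup, map_inf, map_inf, map_inf] at h3
      have h4 : (f x ∧ f v) ∨ (f y ∧ f u) := h3.ge ⟨hy, hv⟩
      tauto
  map_top' := by
    refine propext ⟨fun _ => trivial, fun _ h => ?_⟩
    have : f ⊥ = f ⊤ := h ⊥ ⊤ ((le_top : nabla ⊤ ≤ ⊤) _ _ (by
      change ⊥ ⊔ ⊤ = ⊤ ⊔ ⊤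
      simp))
    simp at this
  map_sSup' S := by
    apply propext
    simp [sSup_image]

theorem assemblyPoint_nabla (f : FrameHom A Prop) (a : A) :
    assemblyPoint f (nabla a) = f a := by
  change (¬ nabla a ≤ ker f) = _
  rw [nabla_le_iff]
  change (¬ f a = f ⊥) = _
  simp

theorem map_eq_not_of_isCompl {N : Type*} [Order.Frame N] (g : FrameHom N Prop) {x y : N}
    (h : IsCompl x y) : g y = ¬ g x := by
  have h1 : g (x ⊓ y) = (g x ∧ g y) := map_inf g x y
  have h2 : g (x ⊔ y) = (g x ∨ g y) := map_sup g x y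
  rw [h.inf_eq_bot, map_bot] at h1
  rw [h.sup_eq_top, map_top] at h2
  have h3 : ¬ (g x ∧ g y) := fun h => h1.ge h
  have h4 : g x ∨ g y := h2.le trivial
  exact propext (by tauto)

theorem assemblyPoint_delta (f : FrameHom A Prop) (a : A) :
    assemblyPoint f (delta a) = ¬ f a := by
  rw [map_eq_not_of_isCompl _ (isCompl_nabla_delta a), assemblyPoint_nabla]

end FrameCongruence

namespace Subframe

variable {A : Type u} [Order.Frame A]

/-- The inclusion of a subframe. -/
def subtype (S : Subframe A) : FrameHom S A where
  toFun x := x.1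
  map_inf' _ _ := rfl
  map_top' := rfl
  map_sSup' T := S.coe_sSup T

theorem isCompl_of_coe {S : Subframe A} {x y : S} (h : IsCompl x.1 y.1) : IsCompl x y := by
  constructor
  · intro z hx hy
    exact Subtype.coe_le_coe.1 ((h.disjoint hx hy).trans bot_le)
  · intro z hx hy
    exact Subtype.coe_le_coe.1 (le_top.trans (h.codisjoint hx hy))

theorem closure_hom_ext {X : Set A} {N : Type v} [Order.Frame N] {f g : FrameHom (closure X) N}
    (h : ∀ x (hx : x ∈ X), f ⟨x, subset_closure X hx⟩ = g ⟨x, subset_closure X hx⟩) : f = g := by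
  let E : Subframe A :=
    { carrier := {x | ∃ hx : x ∈ (closure X).carrier, f ⟨x, hx⟩ = g ⟨x, hx⟩}
      top_mem := ⟨(closure X).top_mem, (map_top f).trans (map_top g).symm⟩
      inf_mem := by
        rintro a b ⟨ha, ha'⟩ ⟨hb, hb'⟩
        refine ⟨(closure X).inf_mem ha hb, ?_⟩
        have hf : f ⟨a ⊓ b, _⟩ = f ⟨a, ha⟩ ⊓ f ⟨b, hb⟩ := map_inf f (⟨a, ha⟩ : closure X) ⟨b, hb⟩
        have hg : g ⟨a ⊓ b, _⟩ = g ⟨a, ha⟩ ⊓ g ⟨b, hb⟩ := map_inf g (⟨a, ha⟩ : closure X) ⟨b, hb⟩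
        rw [hf, hg, ha', hb']
      sSup_mem := fun S hS => by
        have hS' : ∀ x ∈ S, x ∈ (closure X).carrier := fun x hx => (hS hx).1
        refine ⟨(closure X).sSup_mem S hS', ?_⟩
        have e : (⟨sSup S, (closure X).sSup_mem S hS'⟩ : closure X) =
            sSup {x : closure X | x.1 ∈ S} := Subtype.ext (by
          rw [coe_sSup]
          refine congrArg sSup (Set.ext fun x => ?_)
          exact ⟨fun hx => ⟨⟨x, hS' x hx⟩, hx, rfl⟩, by
            rintro ⟨y, hy, rfl⟩
            exact hy⟩)
        rw [e, map_sSup, map_sSup]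
        congr 1
        refine Set.image_congr fun x hx => ?_
        obtain ⟨_, hx'⟩ := hS hx
        exact hx' }
  ext x
  obtain ⟨_, hx⟩ := closure_subset (S := E) (fun x hx => ⟨subset_closure X hx, h x hx⟩) x.2
  exact hx

end Subframe

namespace Biframe

open FrameCongruence Topology

/-- The point of the assembly given by a point of a biframe. -/
noncomputable def toAssemblyPoint {L : Biframe.{u}} (f : Hom L two) : Hom L.assembly two where
  pos := (assemblyPoint f.main).comp L.posAssembly.subtype
  neg := (assemblyPoint f.main).comp L.negAssembly.subtype
  exists_main := ⟨(assemblyPoint f.main).comp L.finAssembly.subtype, fun _ => rfl, fun _ => rfl⟩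

theorem bptMap_toAssemblyPoint {L : Biframe.{u}} (f : Hom L two) :
    L.nablaMap.comp (toAssemblyPoint f) = f :=
  Hom.ext (FrameHom.ext fun a => (assemblyPoint_nabla f.main _).trans (f.main_incPos a))
    (FrameHom.ext fun b => (assemblyPoint_nabla f.main _).trans (f.main_incNeg b))

/-- At a point of the assembly, `Δ(b)` takes the value opposite to `∇(b)`. -/
theorem assembly_pos_delta {L : Biframe.{u}} (h : Hom L.assembly two) (b : L.Neg) :
    h.pos ⟨delta (L.incNeg b), Subframe.subset_closure _ (Or.inr ⟨b, rfl⟩)⟩ =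
      ¬ h.neg (L.nablaMap.neg b) := by
  have h1 := h.main_incPos ⟨delta (L.incNeg b), Subframe.subset_closure _ (Or.inr ⟨b, rfl⟩)⟩
  have h2 := h.main_incNeg (L.nablaMap.neg b)
  refine h1.symm.trans ((map_eq_not_of_isCompl h.main ?_).trans (congrArg Not h2))
  exact Subframe.isCompl_of_coe (isCompl_nabla_delta _)

theorem assembly_neg_delta {L : Biframe.{u}} (h : Hom L.assembly two) (a : L.Pos) :
    h.neg ⟨delta (L.incPos a), Subframe.subset_closure _ (Or.inr ⟨a, rfl⟩)⟩ =
      ¬ h.pos (L.nablaMap.pos a) := by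
  have h1 := h.main_incNeg ⟨delta (L.incPos a), Subframe.subset_closure _ (Or.inr ⟨a, rfl⟩)⟩
  have h2 := h.main_incPos (L.nablaMap.pos a)
  refine h1.symm.trans ((map_eq_not_of_isCompl h.main ?_).trans (congrArg Not h2))
  exact Subframe.isCompl_of_coe (isCompl_nabla_delta _)

theorem toAssemblyPoint_bptMap {L : Biframe.{u}} (h : Hom L.assembly two) :
    toAssemblyPoint (L.nablaMap.comp h) = h := by
  refine Hom.ext (Subframe.closure_hom_ext ?_) (Subframe.closure_hom_ext ?_)
  · rintro _ (⟨a, rfl⟩ | ⟨b, rfl⟩)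
    · exact (assemblyPoint_nabla _ _).trans (Hom.main_incPos _ a)
    · exact (assemblyPoint_delta _ _).trans ((congrArg Not (Hom.main_incNeg _ b)).trans
        (assembly_pos_delta h b).symm)
  · rintro _ (⟨b, rfl⟩ | ⟨a, rfl⟩)
    · exact (assemblyPoint_nabla _ _).trans (Hom.main_incNeg _ b)
    · exact (assemblyPoint_delta _ _).trans ((congrArg Not (Hom.main_incPos _ a)).trans
        (assembly_neg_delta h a).symm)

/-- The congruences whose associated set of points is open in a given topology form a subframe. -/
def openCongruences {L : Biframe.{u}} (τ : TopologicalSpace (Hom L two)) :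
    Subframe (FrameCongruence L.Main) where
  carrier := {C | IsOpen[τ] {f : Hom L two | assemblyPoint f.main C}}
  top_mem := by
    simp only [Set.mem_ofPred_eq, map_top]
    exact τ.isOpen_univ
  inf_mem {C D} hC hD := by
    simp only [Set.mem_ofPred_eq, map_inf] at *
    exact τ.isOpen_inter _ _ hC hD
  sSup_mem S hS := by
    have e : {f : Hom L two | assemblyPoint f.main (sSup S)} =
        ⋃ C ∈ S, {f : Hom L two | assemblyPoint f.main C} := by
      ext f
      simp [map_sSup, sSup_image]
    rw [Set.mem_ofPred_eq, e]
    exact isOpen_biUnion fun C hC => hS hC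

/-- The bihomeomorphism between the Skula bispace of the bispectrum and the bispectrum of the
assembly. -/
noncomputable def skulaBihomeo (L : Biframe.{u}) : Bispace.Bihomeo L.bpt.skula L.assembly.bpt where
  toFun f := toAssemblyPoint (f : Hom L two)
  invFun h := bptMap L.nablaMap h
  left_inv f := bptMap_toAssemblyPoint (f : Hom L two)
  right_inv h := toAssemblyPoint_bptMap (h : Hom L.assembly two)
  continuous_pos := by
    refine continuous_def.2 ?_
    rintro _ ⟨⟨C, hC⟩, rfl⟩
    refine hC (openCongruences L.bpt.skula.pos) ?_
    rintro _ (⟨a, rfl⟩ | ⟨b, rfl⟩)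
    · have e : {f : Hom L two | assemblyPoint f.main (nabla (L.incPos a))} =
          {f : Hom L two | f.pos a} := Set.ext fun f => iff_of_eq
        ((assemblyPoint_nabla _ _).trans (f.main_incPos a))
      exact .basic _ (Or.inl ⟨a, e⟩)
    · have e : {f : Hom L two | assemblyPoint f.main (delta (L.incNeg b))} =
          {f : Hom L two | f.neg b}ᶜ := Set.ext fun f => iff_of_eq
        ((assemblyPoint_delta _ _).trans (congrArg Not (f.main_incNeg b)))
      refine .basic _ (Or.inr ?_)
      dsimp only
      rw [e]
      exact (@isClosed_compl_iff _ L.bpt.neg _).2 ⟨b, rfl⟩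
  continuous_neg := by
    refine continuous_def.2 ?_
    rintro _ ⟨⟨C, hC⟩, rfl⟩
    refine hC (openCongruences L.bpt.skula.neg) ?_
    rintro _ (⟨b, rfl⟩ | ⟨a, rfl⟩)
    · have e : {f : Hom L two | assemblyPoint f.main (nabla (L.incNeg b))} =
          {f : Hom L two | f.neg b} := Set.ext fun f => iff_of_eq
        ((assemblyPoint_nabla _ _).trans (f.main_incNeg b))
      exact .basic _ (Or.inl ⟨b, e⟩)
    · have e : {f : Hom L two | assemblyPoint f.main (delta (L.incPos a))} =
          {f : Hom L two | f.pos a}ᶜ := Set.ext fun f => iff_of_eq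
        ((assemblyPoint_delta _ _).trans (congrArg Not (f.main_incPos a)))
      refine .basic _ (Or.inr ?_)
      dsimp only
      rw [e]
      exact (@isClosed_compl_iff _ L.bpt.pos _).2 ⟨a, rfl⟩
  continuous_inv_pos := by
    refine continuous_generateFrom_iff.2 ?_
    rintro U (⟨a, rfl⟩ | hU)
    · exact ⟨L.nablaMap.pos a, rfl⟩
    · obtain ⟨b, hb⟩ := (@isOpen_compl_iff _ U L.bpt.neg).2 hU
      rw [← compl_compl U, hb]
      exact ⟨_, Set.ext fun h => iff_of_eq (assembly_pos_delta h b).symm⟩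
  continuous_inv_neg := by
    refine continuous_generateFrom_iff.2 ?_
    rintro U (⟨a, rfl⟩ | hU)
    · exact ⟨L.nablaMap.neg a, rfl⟩
    · obtain ⟨b, hb⟩ := (@isOpen_compl_iff _ U L.bpt.pos).2 hU
      rw [← compl_compl U, hb]
      exact ⟨_, Set.ext fun h => iff_of_eq (assembly_neg_delta h b).symm⟩

/-! ### The equivalences -/

/-- Bispatial biquotients correspond to the closed sets of the patch of the Skula bispace. -/
noncomputable def bispatialEquivCloseds {L : Biframe.{u}} (hL : L.IsFinitary) :
    L.BispatialBiquotient ≃o @TopologicalSpace.Closeds L.bpt L.bpt.skulaPatch :=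
  (bispatialEquiv hL).trans
    { toFun := fun Y => @TopologicalSpace.Closeds.mk L.bpt L.bpt.skulaPatch Y.1
        ((hull_eq_self_iff Y.1).1 Y.2)
      invFun := fun Z => ⟨(Z : Set L.bpt), (hull_eq_self_iff _).2
        (@TopologicalSpace.Closeds.isClosed L.bpt L.bpt.skulaPatch Z)⟩
      left_inv := fun _ => rfl
      right_inv := fun _ => rfl
      map_rel_iff' := Iff.rfl }

theorem isPatchDiscrete_iff_hull {L : Biframe.{u}} :
    L.bpt.skula.IsPatchDiscrete ↔ ∀ Y : Set L.bpt, hull Y = Y := by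
  simp only [hull_eq_self_iff]
  constructor
  · exact fun h Y => (@isOpen_compl_iff _ Y L.bpt.skulaPatch).1 (h Yᶜ)
  · intro h Y
    exact (@isClosed_compl_iff _ L.bpt.skulaPatch Y).1 (h Yᶜ)

end Biframe

/-- A `T₁` space whose lattice of closed sets is Boolean is discrete: complements of closed sets in
this lattice are set-theoretic complements, so that singletons are open. -/
theorem isOpen_of_isBooleanOrder_closeds {X : Type u} [TopologicalSpace X]
    (hX : ∀ x : X, IsClosed ({x} : Set X)) (h : IsBooleanOrder (TopologicalSpace.Closeds X))
    (U : Set X) : IsOpen U := by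
  obtain ⟨Q, _, ⟨e⟩⟩ := h
  have hopen (x : X) : IsOpen ({x} : Set X) := by
    let Z : TopologicalSpace.Closeds X := ⟨{x}, hX x⟩
    have hc : IsCompl Z (e.symm (e Z)ᶜ) := by
      have : IsCompl (e.symm (e Z)) (e.symm (e Z)ᶜ) := e.symm.isCompl isCompl_compl
      rwa [e.symm_apply_apply] at this
    have hc' : IsCompl (Z : Set X) (e.symm (e Z)ᶜ : TopologicalSpace.Closeds X) := by
      refine isCompl_iff.2 ⟨disjoint_iff.2 ?_, codisjoint_iff.2 ?_⟩
      · exact congrArg (fun W : TopologicalSpace.Closeds X => (W : Set X)) hc.inf_eq_bot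
      · exact congrArg (fun W : TopologicalSpace.Closeds X => (W : Set X)) hc.sup_eq_top
    have := (e.symm (e Z)ᶜ).isClosed
    rw [← hc'.compl_eq] at this
    exact isClosed_compl_iff.1 this
  rw [← Set.biUnion_of_singleton U]
  exact isOpen_biUnion fun x _ => hopen x

theorem mainTheorem12 (L : Biframe.{u}) (hL : L.IsFinitary) :
    (∃ α : Bispace.Bihomeo L.bpt.skula L.assembly.bpt,
      ∀ f, Biframe.bptMap L.nablaMap (α.toEquiv f) = f) ∧
    IsCoframeOrder L.BispatialBiquotient ∧
    (∃ e : L.BispatialBiquotient ≃o {Y : Set L.bpt // (L.bpt.subspace Y).IsBisober},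
      ∀ Q, (e Q : Set L.bpt) = Q.1.points) ∧
    List.TFAE [
      L.bpt.IsBiTD,
      L.bpt.skula.IsPatchDiscrete,
      L.assembly.bpt.IsPatchDiscrete,
      IsBooleanOrder L.BispatialBiquotient,
      ∀ Y : Set L.bpt, (L.bpt.subspace Y).IsBisober,
      ∃ e : L.BispatialBiquotient ≃o Set L.bpt, ∀ Q, e Q = Q.1.points] := by
  refine ⟨⟨L.skulaBihomeo, L.skulaBihomeo.left_inv⟩, ?_, ?_, ?_⟩
  · let _ := L.bpt.skulaPatch
    exact ⟨TopologicalSpace.Closeds L.bpt, inferInstance, ⟨Biframe.bispatialEquivCloseds hL⟩⟩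
  · exact ⟨(Biframe.bispatialEquiv hL).trans (OrderIso.setCongr _ _ (Set.ext fun Y =>
      (Biframe.subspace_isBisober_iff hL Y).symm)), fun _ => rfl⟩
  · have hpoints : L.bpt.skula.IsPatchDiscrete →
        ∃ e : L.BispatialBiquotient ≃o Set L.bpt, ∀ Q, e Q = Q.1.points := fun h =>
      ⟨(Biframe.bispatialEquiv hL).trans ((OrderIso.setCongr _ _
        (Set.eq_univ_of_forall (Biframe.isPatchDiscrete_iff_hull.1 h))).trans OrderIso.Set.univ),
        fun _ => rfl⟩
    tfae_have 1 ↔ 2 := L.bpt.isBiTD_iff_skula_isPatchDiscrete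
    tfae_have 2 ↔ 3 := L.skulaBihomeo.isPatchDiscrete_iff
    tfae_have 2 ↔ 5 := by
      rw [Biframe.isPatchDiscrete_iff_hull]
      exact forall_congr' fun Y => (Biframe.subspace_isBisober_iff hL Y).symm
    tfae_have 2 → 6 := hpoints
    tfae_have 6 → 2 := by
      rintro ⟨e, he⟩
      refine Biframe.isPatchDiscrete_iff_hull.2 fun Y => ?_
      rw [← e.apply_symm_apply Y, he]
      exact (e.symm Y).1.hull_points
    tfae_have 2 → 4 := fun h => ⟨Set L.bpt, inferInstance, ⟨(hpoints h).choose⟩⟩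
    tfae_have 4 → 2 := by
      rintro ⟨Q, hQ, ⟨e⟩⟩
      let _ := L.bpt.skulaPatch
      exact isOpen_of_isBooleanOrder_closeds (X := L.bpt)
        (fun f => (Biframe.hull_eq_self_iff _).1 (Biframe.hull_singleton f))
        ⟨Q, hQ, ⟨(Biframe.bispatialEquivCloseds hL).symm.trans e⟩⟩
    tfae_finish
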